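/- Let $n\ge 3$, let $K\subset\mathbb R^{n-1}$ be compact, let $U\subset\mathbb R_x\times\mathbb R^{n-1}_y$ be an open neighbourhood of $\{0\}\times K$ and let $\delta_0>0$. For $(x,y)\in U$, $|\lambda|<\delta_0$, $\omega\in\mathbb S^{n-2}$ let $\gamma_{x,y,\lambda,\omega}:(-\delta_0,\delta_0)\to\mathbb R\times\mathbb R^{n-1}$ be curves depending smoothly on all parameters, with $$\gamma_{x,y,\lambda,\omega}(0)=(x,y),\qquad \gamma'_{x,y,\lambda,\omega}(0)=(\lambda,\omega),\qquad \gamma''_{x,y,\lambda,\omega}(t)=2\big(\alpha(x,y,\lambda,\omega,t),\beta(x,y,\lambda,\omega,t)\big),$$ where $\alpha,\beta$ are smooth and $\alpha\ge C$ for some constant $C>0$. Call $\chi=\chi(s,y,\omega)$ a cutoff if it is real-valued and smooth in $s\in\mathbb R$, in $y$ in a neighbourhood of $K$ and in $\omega\in\mathbb S^{n-2}$, with compact support in $s$, uniformly in $(y,\omega)$. For a cutoff $\chi$, $F>0$ and $x>0$ small put $$(Af)(x,y)=\int\int_{\mathbb S^{n-2}}\Big(\int_{-\delta_0}^{\delta_0}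 f(\gamma_{x,y,\lambda,\omega}(t))\,dt\Big)\,x^{-1}\chi(\lambda/x,y,\omega)\,d\omega\,d\lambda,\qquad A_F=x^{-1}e^{-F/x}Ae^{F/x}.$$ Let $X=(x'-x)/x^2$ and $Y=(y'-y)/x$. An integrable function $k(X,Y)$ is the front-face kernel of an operator $P$ at $y$ if the Schwartz kernel of $P$ at $(x,y)$, written with respect to $dX\,dY$, converges to $k$ as a distribution in $(X,Y)$ as $x\to0^+$, i.e. if for every $\varphi\in C_c^\infty(\mathbb R\times\mathbb R^{n-1})$, as $x\to0^+$, $$\Big(P\big[(x',y')\mapsto\varphi\big(\tfrac{x'-x}{x^2},\tfrac{y'-y}{x}\big)\big]\Big)(x,y)\to\int k\,\varphi\,dX\,dY .$$ The boundary principal symbol of $P$ (as a scattering operator of order $(-1,0)$) at $y$ is then the Fourier transform $\sigma(y,\xi,\eta)=\int e^{-i(\xi X+\eta\cdot Y)}k(X,Y)\,dX\,dY$. It is elliptic over $K$ if there is $c>0$ with $|\sigma(y,\xi,\eta)|\ge c\,(1+\xi^2+|\eta|^2)^{-1/2}$ for all $y\in K$, $\xi\in\mathbb R$, $\eta\in\mathbb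 R^{n-1}$. Let $F>0$. Then: (a) For every cutoff $\chi$ and every $y\in K$, the front-face kernel of $A_F$ at $y$ is the integrable function $$\tilde K(y,X,Y)=e^{-FX}|Y|^{-n+1}\Big\{\chi\Big(\tfrac{X-\alpha(0,y,0,\hat Y,0)|Y|^2}{|Y|},y,\hat Y\Big)+\chi\Big(\tfrac{-X+\alpha(0,y,0,-\hat Y,0)|Y|^2}{|Y|},y,-\hat Y\Big)\Big\},\qquad \hat Y=\tfrac{Y}{|Y|},$$ and hence the boundary principal symbol of $A_F$ at $y$ is the $(X,Y)$-Fourier transform of $\tilde K(y,\cdot,\cdot)$. (b) There is a cutoff $\chi$ with $\chi\ge0$ and $\chi(0,y,\omega)=1$ for all $y,\omega$ such that the boundary principal symbol of $A_F$ is elliptic over $K$. -/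

import Mathlib

open MeasureTheory Set Filter Topology
open scoped ContDiff

noncomputable section

namespace LocalXray

/-- The tangential variables `y ∈ ℝ^(n-1)`, with the Euclidean norm. -/
abbrev Tang (n : ℕ) : Type := EuclideanSpace ℝ (Fin (n - 1))

/-- The parameters `(x, y, l, θ, t)` with `(x, y) ∈ U`, `|l| < δ`, `θ` in the unit sphere of
`ℝ^(n-1)` and `|t| < δ`. Functions of `θ` are written as functions on `ℝ^(n-1)` of which only the
values on the unit sphere are used. -/
def paramDomain (n : ℕ) (U : Set (ℝ × Tang n)) (δ : ℝ) : Set (ℝ × Tang n × ℝ × Tang n × ℝ) :=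
  {p | (p.1, p.2.1) ∈ U ∧ |p.2.2.1| < δ ∧ p.2.2.2.1 ∈ Metric.sphere (0 : Tang n) 1 ∧
    |p.2.2.2.2| < δ}

/-- A smooth family of curves `t ↦ γ x y l θ t` in `ℝ × ℝ^(n-1)`, defined for `(x, y)` in a
neighbourhood `U` of `{0} × K` and `|l|, |t| < δ₀`, which starts at `(x, y)` with velocity `(l, θ)`
and has acceleration `2 (α, β)`, where `α` is bounded below by a positive constant.

Smoothness is `ContDiffOn` on a set of the form (open set) × sphere × (open interval); this is the
same as smoothness on that submanifold. -/
structure CurveFamily (n : ℕ) (K : Set (Tang n)) where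
  U : Set (ℝ × Tang n)
  isOpen_U : IsOpen U
  mem_U : ∀ y ∈ K, ((0 : ℝ), y) ∈ U
  δ₀ : ℝ
  δ₀_pos : 0 < δ₀
  γ : ℝ → Tang n → ℝ → Tang n → ℝ → ℝ × Tang n
  α : ℝ → Tang n → ℝ → Tang n → ℝ → ℝ
  β : ℝ → Tang n → ℝ → Tang n → ℝ → Tang n
  smooth_γ : ContDiffOn ℝ ∞
    (fun p : ℝ × Tang n × ℝ × Tang n × ℝ => γ p.1 p.2.1 p.2.2.1 p.2.2.2.1 p.2.2.2.2)
    (paramDomain n U δ₀)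
  smooth_α : ContDiffOn ℝ ∞
    (fun p : ℝ × Tang n × ℝ × Tang n × ℝ => α p.1 p.2.1 p.2.2.1 p.2.2.2.1 p.2.2.2.2)
    (paramDomain n U δ₀)
  smooth_β : ContDiffOn ℝ ∞
    (fun p : ℝ × Tang n × ℝ × Tang n × ℝ => β p.1 p.2.1 p.2.2.1 p.2.2.2.1 p.2.2.2.2)
    (paramDomain n U δ₀)
  position : ∀ x y l θ, (x, y) ∈ U → |l| < δ₀ → θ ∈ Metric.sphere (0 : Tang n) 1 →
    γ x y l θ 0 = (x, y)
  velocity : ∀ x y l θ, (x, y) ∈ U → |l| < δ₀ → θ ∈ Metric.sphere (0 : Tang n) 1 →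
    HasDerivAt (γ x y l θ) (l, θ) 0
  acceleration : ∀ x y l θ t, (x, y, l, θ, t) ∈ paramDomain n U δ₀ →
    iteratedDeriv 2 (γ x y l θ) t = (2 : ℝ) • (α x y l θ t, β x y l θ t)
  convex : ∃ C : ℝ, 0 < C ∧ ∀ x y l θ t, (x, y, l, θ, t) ∈ paramDomain n U δ₀ →
    C ≤ α x y l θ t

/-- `χ s y θ` is a smooth cutoff: it depends smoothly on `s ∈ ℝ`, on `y` in a neighbourhood of `K`
and on `θ` in the unit sphere, and its support in `s` is compact, uniformly in `y` and `θ`. -/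
def IsCutoff {n : ℕ} (K : Set (Tang n)) (χ : ℝ → Tang n → Tang n → ℝ) : Prop :=
  ∃ V : Set (Tang n), IsOpen V ∧ K ⊆ V ∧
    ContDiffOn ℝ ∞ (fun p : ℝ × Tang n × Tang n => χ p.1 p.2.1 p.2.2)
      (univ ×ˢ V ×ˢ Metric.sphere (0 : Tang n) 1) ∧
    ∃ R : ℝ, ∀ s : ℝ, ∀ y ∈ V, ∀ θ ∈ Metric.sphere (0 : Tang n) 1, R < |s| → χ s y θ = 0

/-- The ray transform `(I f)(x, y, l, θ)`: the integral of `f` along `γ x y l θ` on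
`(-δ₀, δ₀)`. -/
def rayTransform {n : ℕ} {K : Set (Tang n)} (𝒢 : CurveFamily n K) (f : ℝ × Tang n → ℂ)
    (x : ℝ) (y : Tang n) (l : ℝ) (θ : Tang n) : ℂ :=
  ∫ t in Ioo (-𝒢.δ₀) 𝒢.δ₀, f (𝒢.γ x y l θ t)

/-- The operator `(A f)(x, y) = ∫ ∫ (I f)(x, y, l, θ) x⁻¹ χ(l / x, y, θ) dθ dl`, with the surface
measure of the unit sphere in `θ`. For `χ` of compact support and small `x > 0` the restriction
to `|l| < δ₀` is automatic on the support of the integrand. -/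
def opA {n : ℕ} {K : Set (Tang n)} (𝒢 : CurveFamily n K) (χ : ℝ → Tang n → Tang n → ℝ)
    (f : ℝ × Tang n → ℂ) (z : ℝ × Tang n) : ℂ :=
  ∫ l in Ioo (-𝒢.δ₀) 𝒢.δ₀, ∫ θ : Metric.sphere (0 : Tang n) 1,
    rayTransform 𝒢 f z.1 z.2 l (θ : Tang n) *
      ((z.1⁻¹ * χ (l / z.1) z.2 (θ : Tang n) : ℝ) : ℂ) ∂((volume : Measure (Tang n)).toSphere)

/-- The conjugated operator `A_F = x⁻¹ e^(-F/x) A e^(F/x)`. -/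
def opAF {n : ℕ} {K : Set (Tang n)} (𝒢 : CurveFamily n K) (χ : ℝ → Tang n → Tang n → ℝ) (F : ℝ)
    (f : ℝ × Tang n → ℂ) (z : ℝ × Tang n) : ℂ :=
  ((z.1⁻¹ * Real.exp (-F / z.1) : ℝ) : ℂ) *
    opA 𝒢 χ (fun w => ((Real.exp (F / w.1) : ℝ) : ℂ) * f w) z

/-- The function `z' = (x', y') ↦ φ(X, Y)`, where `X = (x' - x) / x²` and `Y = (y' - y) / x` are
the scattering coordinates centred at `(x, y)`. -/
def scatteringPullback {n : ℕ} (φ : ℝ × Tang n → ℂ) (x : ℝ) (y : Tang n) : ℝ × Tang n → ℂ :=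
  fun w => φ ((w.1 - x) / x ^ 2, x⁻¹ • (w.2 - y))

/-- `k` is the restriction to the scattering front face, over the boundary point `y`, of the
Schwartz kernel of `P`. If `K_P(x, y, X, Y)` is the kernel with respect to `dX dY`, so that
`(P f)(x, y) = ∫ K_P(x, y, X, Y) f(x + x² X, y + x Y) dX dY`, this says that
`K_P(x, y, ·, ·)` tends to the integrable function `k` as a distribution in `(X, Y)` when
`x → 0+`. -/
def HasFrontFaceKernel {n : ℕ} (P : (ℝ × Tang n → ℂ) → ℝ × Tang n → ℂ) (y : Tang n)
    (k : ℝ × Tang n → ℂ) : Prop :=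
  Integrable k ∧ ∀ φ : ℝ × Tang n → ℂ, ContDiff ℝ ∞ φ → HasCompactSupport φ →
    Tendsto (fun x : ℝ => P (scatteringPullback φ x y) (x, y)) (𝓝[>] 0) (𝓝 (∫ w, k w * φ w))

/-- The Fourier transform in `(X, Y)`, with dual variables `(ξ, η)`. -/
def fourierXY {n : ℕ} (k : ℝ × Tang n → ℂ) (ξ : ℝ) (η : Tang n) : ℂ :=
  ∫ w : ℝ × Tang n, Complex.exp (-Complex.I * ((ξ * w.1 + inner ℝ η w.2 : ℝ) : ℂ)) * k w

/-- `σ` is the boundary principal symbol at `y` of the scattering operator `P` (of order `(-1, 0)`,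
so that its kernel on the front face is integrable): the Fourier transform in `(X, Y)` of the
restriction of the Schwartz kernel to the front face. -/
def HasBoundarySymbol {n : ℕ} (P : (ℝ × Tang n → ℂ) → ℝ × Tang n → ℂ) (y : Tang n)
    (σ : ℝ → Tang n → ℂ) : Prop :=
  ∃ k : ℝ × Tang n → ℂ, HasFrontFaceKernel P y k ∧ σ = fourierXY k

/-- The boundary principal symbol is unique. -/
theorem HasBoundarySymbol.unique {n : ℕ} {P : (ℝ × Tang n → ℂ) → ℝ × Tang n → ℂ} {y : Tang n}
    {σ τ : ℝ → Tang n → ℂ} (hσ : HasBoundarySymbol P y σ) (hτ : HasBoundarySymbol P y τ) :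
    σ = τ := by
  obtain ⟨k, ⟨hk, hk'⟩, rfl⟩ := hσ
  obtain ⟨m, ⟨hm, hm'⟩, rfl⟩ := hτ
  have h : k =ᵐ[volume] m := by
    refine ae_eq_of_integral_contDiff_smul_eq hk.locallyIntegrable hm.locallyIntegrable ?_
    intro g hg hgs
    have hc : ContDiff ℝ ∞ (fun w => ((g w : ℝ) : ℂ)) := Complex.ofRealCLM.contDiff.comp hg
    have hs : HasCompactSupport (fun w => ((g w : ℝ) : ℂ)) :=
      hgs.comp_left (g := fun r : ℝ => (r : ℂ)) Complex.ofReal_zero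
    have e := tendsto_nhds_unique (hk' _ hc hs) (hm' _ hc hs)
    simpa [Complex.real_smul, mul_comm] using e
  funext ξ η
  refine integral_congr_ae ?_
  filter_upwards [h] with w hw
  rw [hw]

/-- The Japanese bracket `⟨(ξ, η)⟩ = (1 + ξ² + |η|²)^(1/2)`. -/
def japanese {n : ℕ} (ξ : ℝ) (η : Tang n) : ℝ := Real.sqrt (1 + ξ ^ 2 + ‖η‖ ^ 2)

/-- The boundary principal symbol of `P`, as a scattering operator of order `(-1, 0)`, exists and
is elliptic over `K`: it is bounded below in absolute value by `c ⟨(ξ, η)⟩⁻¹` with `c > 0`,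
uniformly over `K`. -/
def IsBoundaryElliptic {n : ℕ} (K : Set (Tang n)) (P : (ℝ × Tang n → ℂ) → ℝ × Tang n → ℂ) :
    Prop :=
  ∃ σ : Tang n → ℝ → Tang n → ℂ, (∀ y ∈ K, HasBoundarySymbol P y (σ y)) ∧
    ∃ c : ℝ, 0 < c ∧ ∀ y ∈ K, ∀ (ξ : ℝ) (η : Tang n), c * (japanese ξ η)⁻¹ ≤ ‖σ y ξ η‖

/-- The explicit kernel
`e^(-F X) |Y|^(1-n) { χ((X - α(0,y,0,Ŷ,0) |Y|²) / |Y|, y, Ŷ)`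
`+ χ((-X + α(0,y,0,-Ŷ,0) |Y|²) / |Y|, y, -Ŷ) }`, where `Ŷ = Y / |Y|`. -/
def boundaryKernel {n : ℕ} {K : Set (Tang n)} (𝒢 : CurveFamily n K)
    (χ : ℝ → Tang n → Tang n → ℝ) (F : ℝ) (y : Tang n) (w : ℝ × Tang n) : ℂ :=
  let X : ℝ := w.1
  let r : ℝ := ‖w.2‖
  let Yhat : Tang n := ‖w.2‖⁻¹ • w.2
  ((Real.exp (-F * X) * r ^ (1 - (n : ℤ)) *
    (χ ((X - 𝒢.α 0 y 0 Yhat 0 * r ^ 2) / r) y Yhat +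
      χ ((-X + 𝒢.α 0 y 0 (-Yhat) 0 * r ^ 2) / r) y (-Yhat)) : ℝ) : ℂ)

end LocalXray

end

/-! For (a), substitute `l = x s`, `t = x τ`. The two Jacobians cancel the factors `x⁻¹` of the
operator and of its conjugation. By Taylor's formula the scattering coordinates of the point reached
tend to `X = s τ + α τ²`, `Y = τ θ`, and `F / x' - F / x` tends to `-F X`. Since `α ≥ C > 0` and `φ`
has compact support, the rescaled integrands live in one compact set and are uniformly bounded, so
dominated convergence applies (`tendsto_opAF`). The map `(s, θ, τ) ↦ (X, Y)`, with Jacobian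
`|τ|^(n-1)`, turns the limit into an integral against the stated kernel; the signs of `τ` give its
two terms (`integral_two_sided`, `integral_boundaryKernel_mul`).

For (b), the ideal profile is the Gaussian `χ = exp (-F s² / (2 α))`. After scaling `s` and `τ`, the
symbol is an integral over the sphere of model integrals with phase `(1 + i ξ)(s t + t²)`. The
`s`-integration contributes `(1 + i ξ)² t² / 2`, whose imaginary part cancels that of `-(1 + i ξ)
t²`. The model integral is therefore a positive Gaussian, `(2π / w) exp (-q² / (2 w²))` with `w² = 1
+ ξ²` (`integral_model_gaussian`).

A cutoff needs compact support, so the Gaussian is multiplied by a very wide bump. Written as a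
superposition of plane waves, the bump perturbs the model integral by an arbitrarily small multiple
of a wider Gaussian, uniformly in the frequencies (`exists_modelSymbol_approx`). Since `∫ exp (-B
⟪e, θ⟫²) dθ` is comparable to `(1 + B)^(-1/2)` on spheres of positive dimension, the main term has
size `⟨(ξ, η)⟩⁻¹` and absorbs the error (`exists_elliptic_cutoff`). -/

noncomputable section

set_option linter.unusedSectionVars false

namespace LocalXray

/-! ### Polar coordinates combined with the shear `X = s t + a(θ) t²`. -/

section Polar

variable {E : Type*} [NormedAddCommGroup E] [NormedSpace ℝ E] [FiniteDimensional ℝ E]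
  [MeasurableSpace E] [BorelSpace E] (μ : Measure E) [μ.IsAddHaarMeasure]
  {F : Type*} [NormedAddCommGroup F] [NormedSpace ℝ F]

/-- Lebesgue measure on the open half-line. -/
abbrev halfLine : Measure (Ioi (0 : ℝ)) := Measure.comap Subtype.val volume

theorem measurePreserving_val_halfLine :
    MeasurePreserving ((↑) : Ioi (0 : ℝ) → ℝ) halfLine (volume.restrict (Ioi 0)) :=
  ⟨measurable_subtype_coe, map_comap_subtype_coe measurableSet_Ioi _⟩

instance : SigmaFinite halfLine := by
  have : SigmaFinite (halfLine.map ((↑) : Ioi (0 : ℝ) → ℝ)) := by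
    rw [measurePreserving_val_halfLine.map_eq]; infer_instance
  exact SigmaFinite.of_map _ measurable_subtype_coe.aemeasurable this

/-- Polar coordinates in `E` combined with a parameter-dependent affine map of the line. -/
def parabolicPolar (a : Metric.sphere (0 : E) 1 → ℝ) :
    ℝ × (Metric.sphere (0 : E) 1 × Ioi (0 : ℝ)) → ℝ × E :=
  fun q => (q.2.2 * q.1 + a q.2.1 * (q.2.2 : ℝ) ^ 2, (q.2.2 : ℝ) • (q.2.1 : E))

/-- The affine map `s ↦ r s + a r²` of the line, with parameters `θ` and `r`. -/
def shearEquiv (a : Metric.sphere (0 : E) 1 → ℝ) (ha : Measurable a) :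
    ℝ × (Metric.sphere (0 : E) 1 × Ioi (0 : ℝ)) ≃ᵐ
      ℝ × (Metric.sphere (0 : E) 1 × Ioi (0 : ℝ)) where
  toFun q := (q.2.2 * q.1 + a q.2.1 * (q.2.2 : ℝ) ^ 2, q.2)
  invFun q := ((q.1 - a q.2.1 * (q.2.2 : ℝ) ^ 2) / q.2.2, q.2)
  left_inv q := by
    have : (q.2.2 : ℝ) ≠ 0 := (ne_of_gt q.2.2.2)
    ext <;> simp [mul_div_cancel_left₀ _ this]
  right_inv q := by
    have : (q.2.2 : ℝ) ≠ 0 := (ne_of_gt q.2.2.2)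
    ext <;> simp [mul_div_cancel₀ _ this]
  measurable_toFun := by
    simp only [Equiv.coe_fn_mk]
    fun_prop
  measurable_invFun := by
    simp only [Equiv.coe_fn_symm_mk]
    fun_prop

theorem lintegral_toSphere_prod_volumeIoiPow (m : ℕ)
    {f : Metric.sphere (0 : E) 1 × Ioi (0 : ℝ) → ENNReal} (hf : Measurable f) :
    ∫⁻ p, f p ∂(μ.toSphere.prod (Measure.volumeIoiPow m)) =
      ∫⁻ p, ENNReal.ofReal ((p.2 : ℝ) ^ m) * f p ∂(μ.toSphere.prod halfLine) := by
  rw [Measure.volumeIoiPow, prod_withDensity_right (by fun_prop),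
    lintegral_withDensity_eq_lintegral_mul _ (by fun_prop) hf]
  rfl

/-- For fixed `θ` and `r` the shear is an affine map of the line with slope `r`, so it trades one
power of `r` in the radial density for its Jacobian. -/
theorem measurePreserving_shearEquiv (a : Metric.sphere (0 : E) 1 → ℝ) (ha : Measurable a) (m : ℕ) :
    MeasurePreserving (shearEquiv a ha)
      ((volume : Measure ℝ).prod (μ.toSphere.prod (Measure.volumeIoiPow (m + 1))))
      ((volume : Measure ℝ).prod (μ.toSphere.prod (Measure.volumeIoiPow m))) := by
  refine ⟨(shearEquiv a ha).measurable, ?_⟩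
  ext s hs
  rw [Measure.map_apply (shearEquiv a ha).measurable hs, Measure.prod_apply_symm hs,
    Measure.prod_apply_symm ((shearEquiv a ha).measurable hs),
    lintegral_toSphere_prod_volumeIoiPow, lintegral_toSphere_prod_volumeIoiPow]
  · refine lintegral_congr fun p => ?_
    have hp : (0 : ℝ) < p.2 := p.2.2
    have : (fun x : ℝ => (x, p)) ⁻¹' ((shearEquiv a ha) ⁻¹' s) =
        (fun x : ℝ => (p.2 : ℝ) * x) ⁻¹' ((fun x => x + a p.1 * (p.2 : ℝ) ^ 2) ⁻¹'
          ((fun x : ℝ => (x, p)) ⁻¹' s)) := rfl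
    rw [this, Real.volume_preimage_mul_left hp.ne', measure_preimage_add_right, ← mul_assoc,
      ← ENNReal.ofReal_mul (by positivity), abs_of_pos (by positivity), pow_succ,
      mul_inv_cancel_right₀ hp.ne']
  · exact measurable_measure_prodMk_right hs
  · exact measurable_measure_prodMk_right ((shearEquiv a ha).measurable hs)

theorem measurableEmbedding_parabolicPolar (a : Metric.sphere (0 : E) 1 → ℝ) (ha : Measurable a) :
    MeasurableEmbedding (parabolicPolar a) :=
  ((MeasurableEmbedding.id.prodMap (MeasurableEmbedding.subtype_coe
    (measurableSet_singleton (0 : E)).compl)).comp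
    ((MeasurableEquiv.refl ℝ).prodCongr
      (homeomorphUnitSphereProd E).toMeasurableEquiv.symm).measurableEmbedding).comp
    (shearEquiv a ha).measurableEmbedding

/-- Polar coordinates carry the density `r^(dim E - 1)` and the shear contributes one more factor
`r`. -/
theorem measurePreserving_parabolicPolar [Nontrivial E] (a : Metric.sphere (0 : E) 1 → ℝ)
    (ha : Measurable a) :
    MeasurePreserving (parabolicPolar a)
      ((volume : Measure ℝ).prod (μ.toSphere.prod (Measure.volumeIoiPow (Module.finrank ℝ E))))
      ((volume : Measure ℝ).prod μ) := by
  have hd : Module.finrank ℝ E - 1 + 1 = Module.finrank ℝ E :=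
    Nat.sub_add_cancel Module.finrank_pos
  have h := (μ.measurePreserving_homeomorphUnitSphereProd).symm
    (homeomorphUnitSphereProd E).toMeasurableEquiv
  have h2 : MeasurePreserving ((↑) : ({0}ᶜ : Set E) → E) (μ.comap (↑)) μ := by
    refine ⟨measurable_subtype_coe, ?_⟩
    rw [map_comap_subtype_coe (measurableSet_singleton _).compl μ, restrict_compl_singleton]
  have h3 := measurePreserving_shearEquiv μ a ha (Module.finrank ℝ E - 1)
  rw [hd] at h3
  exact ((MeasurePreserving.id volume).prod (h2.comp h)).comp h3

theorem withDensity_volume_prod_toSphere (m : ℕ) :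
    (volume : Measure ℝ).prod (μ.toSphere.prod (Measure.volumeIoiPow m)) =
      ((volume : Measure ℝ).prod (μ.toSphere.prod halfLine)).withDensity
        fun q => ENNReal.ofReal ((q.2.2 : ℝ) ^ m) := by
  rw [Measure.volumeIoiPow, prod_withDensity_right (by fun_prop),
    prod_withDensity_right (by fun_prop)]

theorem integrable_iff_parabolicPolar [Nontrivial E] {a : Metric.sphere (0 : E) 1 → ℝ}
    (ha : Measurable a) (f : ℝ × E → F) :
    Integrable f ((volume : Measure ℝ).prod μ) ↔
      Integrable (fun q => (q.2.2 : ℝ) ^ Module.finrank ℝ E • f (parabolicPolar a q))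
        ((volume : Measure ℝ).prod (μ.toSphere.prod halfLine)) := by
  rw [← (measurePreserving_parabolicPolar μ a ha).integrable_comp_emb
    (measurableEmbedding_parabolicPolar a ha), withDensity_volume_prod_toSphere,
    integrable_withDensity_iff_integrable_smul' (by fun_prop) (by simp)]
  refine integrable_congr (.of_forall fun q => ?_)
  have : (0 : ℝ) < q.2.2 := q.2.2.2
  simp [ENNReal.toReal_ofReal (pow_nonneg this.le _)]

theorem integral_eq_parabolicPolar [Nontrivial E] {a : Metric.sphere (0 : E) 1 → ℝ}
    (ha : Measurable a) (f : ℝ × E → F) :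
    ∫ w, f w ∂((volume : Measure ℝ).prod μ) =
      ∫ q, (q.2.2 : ℝ) ^ Module.finrank ℝ E • f (parabolicPolar a q)
        ∂((volume : Measure ℝ).prod (μ.toSphere.prod halfLine)) := by
  rw [← (measurePreserving_parabolicPolar μ a ha).integral_comp
    (measurableEmbedding_parabolicPolar a ha), withDensity_volume_prod_toSphere,
    integral_withDensity_eq_integral_toReal_smul (by fun_prop) (by simp)]
  refine integral_congr_ae (.of_forall fun q => ?_)
  have : (0 : ℝ) < q.2.2 := q.2.2.2
  simp [ENNReal.toReal_ofReal (pow_nonneg this.le _)]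

section Halves

variable {α : Type*} [MeasurableSpace α] (ν : Measure α) [SigmaFinite ν]

theorem measurePreserving_prod_val_halfLine :
    MeasurePreserving (fun q : ℝ × (α × Ioi (0 : ℝ)) => (q.1, (q.2.1, (q.2.2 : ℝ))))
      ((volume : Measure ℝ).prod (ν.prod halfLine))
      (((volume : Measure ℝ).prod (ν.prod volume)).restrict {p | 0 < p.2.2}) := by
  have := (MeasurePreserving.id (volume : Measure ℝ)).prod
    ((MeasurePreserving.id ν).prod measurePreserving_val_halfLine)
  have e : (volume : Measure ℝ).prod (ν.prod (volume.restrict (Ioi (0 : ℝ)))) =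
      ((volume : Measure ℝ).prod (ν.prod volume)).restrict {p | 0 < p.2.2} := by
    have h1 := Measure.prod_restrict (μ := ν) (ν := (volume : Measure ℝ)) univ (Ioi 0)
    have h2 := Measure.prod_restrict (μ := (volume : Measure ℝ)) (ν := ν.prod (volume : Measure ℝ))
      univ (univ ×ˢ Ioi 0)
    rw [Measure.restrict_univ] at h1 h2
    rw [h1, h2]
    congr 1
    ext p
    simp
  exact e ▸ this

theorem measurableEmbedding_prod_val_halfLine :
    MeasurableEmbedding (fun q : ℝ × (α × Ioi (0 : ℝ)) => (q.1, (q.2.1, (q.2.2 : ℝ)))) :=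
  MeasurableEmbedding.id.prodMap (MeasurableEmbedding.id.prodMap
    (MeasurableEmbedding.subtype_coe measurableSet_Ioi))

/-- Reflection of the first and last variables. -/
def reflectEquiv : ℝ × (α × ℝ) ≃ᵐ ℝ × (α × ℝ) :=
  (MeasurableEquiv.neg ℝ).prodCongr ((MeasurableEquiv.refl α).prodCongr (MeasurableEquiv.neg ℝ))

theorem measurePreserving_reflectEquiv :
    MeasurePreserving (reflectEquiv (α := α)) ((volume : Measure ℝ).prod (ν.prod volume))
      ((volume : Measure ℝ).prod (ν.prod volume)) :=
  (Measure.measurePreserving_neg volume).prod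
    ((MeasurePreserving.id ν).prod (Measure.measurePreserving_neg volume))

theorem ae_last_ne_zero :
    ∀ᵐ p ∂((volume : Measure ℝ).prod (ν.prod (volume : Measure ℝ))), p.2.2 ≠ 0 := by
  have h : ∀ᵐ t ∂(volume : Measure ℝ), t ≠ 0 := Measure.ae_ne volume 0
  exact Measure.quasiMeasurePreserving_snd.ae (Measure.quasiMeasurePreserving_snd.ae h)

/-- An integral over a product with a line is the sum of two integrals over half-lines. -/
theorem integral_eq_halves {G : ℝ × (α × ℝ) → F}
    (hG : Integrable G ((volume : Measure ℝ).prod (ν.prod volume))) :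
    Integrable (fun q : ℝ × (α × Ioi (0 : ℝ)) => G (q.1, (q.2.1, (q.2.2 : ℝ))))
      ((volume : Measure ℝ).prod (ν.prod halfLine)) ∧
    Integrable (fun q : ℝ × (α × Ioi (0 : ℝ)) => G (-q.1, (q.2.1, -(q.2.2 : ℝ))))
      ((volume : Measure ℝ).prod (ν.prod halfLine)) ∧
    ∫ p, G p ∂((volume : Measure ℝ).prod (ν.prod volume)) =
      (∫ q : ℝ × (α × Ioi (0 : ℝ)), G (q.1, (q.2.1, (q.2.2 : ℝ)))
        ∂((volume : Measure ℝ).prod (ν.prod halfLine))) +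
      ∫ q : ℝ × (α × Ioi (0 : ℝ)), G (-q.1, (q.2.1, -(q.2.2 : ℝ)))
        ∂((volume : Measure ℝ).prod (ν.prod halfLine)) := by
  set ρ := (volume : Measure ℝ).prod (ν.prod (volume : Measure ℝ)) with hρ
  set s : Set (ℝ × (α × ℝ)) := {p | 0 < p.2.2} with hs
  have hsm : MeasurableSet s := measurableSet_lt measurable_const (by fun_prop)
  have hr := measurePreserving_reflectEquiv ν
  have hG' : Integrable (G ∘ reflectEquiv) ρ :=
    (hr.integrable_comp_emb reflectEquiv.measurableEmbedding).2 hG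
  have mp := measurePreserving_prod_val_halfLine ν
  have me := measurableEmbedding_prod_val_halfLine (α := α)
  refine ⟨(mp.integrable_comp_emb me).2 hG.integrableOn,
    (mp.integrable_comp_emb me (g := G ∘ reflectEquiv)).2 hG'.integrableOn, ?_⟩
  have e1 := mp.integral_comp me G
  have e2 := mp.integral_comp me (G ∘ reflectEquiv)
  -- Reflecting `s` together with `t` preserves `s t + a t²`, so one shear serves both halves; the
  -- null set `t = 0` accounts for the difference between `sᶜ` and the reflected half.
  have e3 : ∫ p in sᶜ, G p ∂ρ = ∫ p in s, (G ∘ reflectEquiv) p ∂ρ := by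
    have := hr.setIntegral_preimage_emb reflectEquiv.measurableEmbedding G sᶜ
    rw [← this]
    refine setIntegral_congr_set ?_
    filter_upwards [ae_last_ne_zero ν] with p hp
    have : (p ∈ reflectEquiv ⁻¹' sᶜ) = (p ∈ s) := by
      have h : (reflectEquiv p).2.2 = -p.2.2 := rfl
      simp only [hs, mem_preimage, mem_compl_iff, mem_ofPred_eq, not_lt, eq_iff_iff, h, neg_nonpos]
      exact ⟨fun h => lt_of_le_of_ne h hp.symm, le_of_lt⟩
    exact this
  rw [← integral_add_compl hsm hG, e3]
  exact congrArg₂ _ e1.symm e2.symm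

end Halves

/-- Change of variables `X = s t + a(θ) t²`, `Y = t θ` with `t` of both signs. -/
theorem integral_two_sided [Nontrivial E] {a : Metric.sphere (0 : E) 1 → ℝ} (ha : Measurable a)
    {G : ℝ × (Metric.sphere (0 : E) 1 × ℝ) → F}
    (hG : Integrable G ((volume : Measure ℝ).prod (μ.toSphere.prod volume)))
    {f₁ f₂ : ℝ × E → F}
    (h₁ : ∀ (s : ℝ) (θ : Metric.sphere (0 : E) 1) (r : ℝ), 0 < r →
      r ^ Module.finrank ℝ E • f₁ (r * s + a θ * r ^ 2, r • (θ : E)) = G (s, (θ, r)))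
    (h₂ : ∀ (s : ℝ) (θ : Metric.sphere (0 : E) 1) (r : ℝ), 0 < r →
      r ^ Module.finrank ℝ E • f₂ (r * s + a θ * r ^ 2, -(r • (θ : E))) = G (-s, (θ, -r))) :
    Integrable (fun w => f₁ w + f₂ w) ((volume : Measure ℝ).prod μ) ∧
      ∫ w, (f₁ w + f₂ w) ∂((volume : Measure ℝ).prod μ) =
        ∫ p, G p ∂((volume : Measure ℝ).prod (μ.toSphere.prod volume)) := by
  obtain ⟨i₁, i₂, e⟩ := integral_eq_halves μ.toSphere hG
  have k₁ : (fun q : ℝ × (Metric.sphere (0 : E) 1 × Ioi (0 : ℝ)) =>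
      G (q.1, (q.2.1, (q.2.2 : ℝ)))) =
      fun q => (q.2.2 : ℝ) ^ Module.finrank ℝ E • f₁ (parabolicPolar a q) := by
    funext q; exact (h₁ q.1 q.2.1 q.2.2 q.2.2.2).symm
  have k₂ : (fun q : ℝ × (Metric.sphere (0 : E) 1 × Ioi (0 : ℝ)) =>
      G (-q.1, (q.2.1, -(q.2.2 : ℝ)))) =
      fun q => (q.2.2 : ℝ) ^ Module.finrank ℝ E •
        (f₂ ∘ Prod.map id Neg.neg) (parabolicPolar a q) := by
    funext q; exact (h₂ q.1 q.2.1 q.2.2 q.2.2.2).symm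
  -- Negative `t` reaches `Y = -r θ`; composing `f₂` with the measure-preserving map `Y ↦ -Y` brings
  -- this half back to the same polar coordinates.
  have hn : MeasurePreserving (Prod.map id Neg.neg : ℝ × E → ℝ × E)
      ((volume : Measure ℝ).prod μ) ((volume : Measure ℝ).prod μ) :=
    (MeasurePreserving.id volume).prod (Measure.measurePreserving_neg μ)
  have hne : MeasurableEmbedding (Prod.map id Neg.neg : ℝ × E → ℝ × E) :=
    ((MeasurableEquiv.refl ℝ).prodCongr (MeasurableEquiv.neg E)).measurableEmbedding
  rw [k₁, ← integrable_iff_parabolicPolar μ ha] at i₁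
  rw [k₂, ← integrable_iff_parabolicPolar μ ha, hn.integrable_comp_emb hne] at i₂
  refine ⟨i₁.add i₂, ?_⟩
  rw [integral_add i₁ i₂, e, k₁, k₂, ← integral_eq_parabolicPolar μ ha,
    ← integral_eq_parabolicPolar μ ha]
  congr 1
  exact (hn.integral_comp hne f₂).symm

end Polar

/-! ### Two-sided bounds for Gaussian integrals over the sphere. -/

section SphereGaussian

variable {E : Type*} [NormedAddCommGroup E] [InnerProductSpace ℝ E] [FiniteDimensional ℝ E]
  [MeasurableSpace E] [BorelSpace E]

theorem integral_polar [Nontrivial E] (f : E → ℝ) :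
    ∫ x, f x = ∫ p : Metric.sphere (0 : E) 1 × Ioi (0 : ℝ), f ((p.2 : ℝ) • (p.1 : E))
      ∂((volume : Measure E).toSphere.prod (Measure.volumeIoiPow (Module.finrank ℝ E - 1))) := by
  have h := ((volume : Measure E).measurePreserving_homeomorphUnitSphereProd).integral_comp
    (Homeomorph.measurableEmbedding _) (fun p => f ((p.2 : ℝ) • (p.1 : E)))
  rw [← h, ← restrict_compl_singleton (μ := (volume : Measure E)) 0,
    ← integral_subtype_comap (measurableSet_singleton (0 : E)).compl f, restrict_compl_singleton]
  refine integral_congr_ae (.of_forall fun x => ?_)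
  have : ‖(x : E)‖ ≠ 0 := norm_ne_zero_iff.2 x.2
  simp [smul_smul, mul_inv_cancel₀ this]

theorem integrable_polar [Nontrivial E] {f : E → ℝ} (hf : Integrable f) :
    Integrable (fun p : Metric.sphere (0 : E) 1 × Ioi (0 : ℝ) => f ((p.2 : ℝ) • (p.1 : E)))
      ((volume : Measure E).toSphere.prod
        (Measure.volumeIoiPow (Module.finrank ℝ E - 1))) := by
  rw [← ((volume : Measure E).measurePreserving_homeomorphUnitSphereProd).integrable_comp_emb
    (Homeomorph.measurableEmbedding _)]
  have h : Integrable (f ∘ ((↑) : ({0}ᶜ : Set E) → E))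
      (Measure.comap ((↑) : ({0}ᶜ : Set E) → E) volume) :=
    (integrableOn_iff_comap_subtypeVal (measurableSet_singleton (0 : E)).compl).1 hf.integrableOn
  refine h.congr (.of_forall fun x => ?_)
  have : ‖(x : E)‖ ≠ 0 := norm_ne_zero_iff.2 x.2
  simp [smul_smul, mul_inv_cancel₀ this]

/-- Integral of a product function in an orthonormal frame. -/
theorem integral_prod_orthonormal {ι : Type*} [Fintype ι] (b : OrthonormalBasis ι ℝ E)
    (g : ι → ℝ → ℝ) :
    ∫ x : E, ∏ i, g i (inner ℝ (b i) x) = ∏ i, ∫ t, g i t := by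
  rw [← integral_fintype_prod_volume_eq_prod,
    ← (PiLp.volume_preserving_ofLp ι).integral_comp
      (MeasurableEquiv.toLp 2 (ι → ℝ)).symm.measurableEmbedding,
    ← b.measurePreserving_repr.integral_comp b.repr.toHomeomorph.measurableEmbedding]
  simp [b.repr_apply_apply]

theorem integrable_prod_orthonormal {ι : Type*} [Fintype ι] (b : OrthonormalBasis ι ℝ E)
    {g : ι → ℝ → ℝ} (hg : ∀ i, Integrable (g i)) :
    Integrable fun x : E => ∏ i, g i (inner ℝ (b i) x) := by
  have h := Integrable.fintype_prod (f := g) (μ := fun _ => volume) hg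
  have h2 := (PiLp.volume_preserving_ofLp ι).integrable_comp_of_integrable h
  have h3 := b.measurePreserving_repr.integrable_comp_of_integrable h2
  refine h3.congr (.of_forall fun x => ?_)
  simp [b.repr_apply_apply]

theorem exists_orthonormalBasis_eq {d : ℕ} (hd : Module.finrank ℝ E = d) (i : Fin d) {e : E}
    (he : ‖e‖ = 1) : ∃ b : OrthonormalBasis (Fin d) ℝ E, b i = e := by
  have : Orthonormal ℝ (({i} : Set (Fin d)).domRestrict fun _ => e) := by
    refine ⟨fun _ => he, fun j k hjk => ?_⟩
    exact absurd (Subsingleton.elim j k) hjk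
  obtain ⟨b, hb⟩ := this.exists_orthonormalBasis_extension_of_card_eq (by simp [hd])
  exact ⟨b, hb i rfl⟩

/-- The one-dimensional factors of the Gaussian `exp (-|x|² - B ⟪b i₀, x⟫²)`. -/
def gaussianFactor {ι : Type*} [DecidableEq ι] (i₀ : ι) (B : ℝ) (i : ι) (t : ℝ) : ℝ :=
  Real.exp (-(if i = i₀ then 1 + B else 1) * t ^ 2)

theorem integrable_gaussianFactor {ι : Type*} [DecidableEq ι] (i₀ : ι) {B : ℝ} (hB : 0 ≤ B)
    (i : ι) : Integrable (gaussianFactor i₀ B i) := by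
  refine integrable_exp_neg_mul_sq ?_
  split_ifs <;> linarith

theorem prod_gaussianFactor {ι : Type*} [Fintype ι] [DecidableEq ι] (b : OrthonormalBasis ι ℝ E)
    (i₀ : ι) (B : ℝ) (x : E) :
    ∏ i, gaussianFactor i₀ B i (inner ℝ (b i) x) =
      Real.exp (-‖x‖ ^ 2 - B * (inner ℝ (b i₀) x) ^ 2) := by
  simp only [gaussianFactor, ← Real.exp_sum]
  congr 1
  have h : ∀ i, -(if i = i₀ then 1 + B else 1) * (inner ℝ (b i) x) ^ 2 =
      -(‖(inner ℝ (b i) x : ℝ)‖ ^ 2) - (if i = i₀ then B * (inner ℝ (b i) x) ^ 2 else 0) := by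
    intro i
    split_ifs
    · simp; ring
    · simp
  simp only [h, Finset.sum_sub_distrib, Finset.sum_neg_distrib, b.sum_sq_norm_inner_right x]
  simp

theorem gaussian_smul_sphere (e : E) (B r : ℝ) (θ : Metric.sphere (0 : E) 1) :
    Real.exp (-‖r • (θ : E)‖ ^ 2 - B * (inner ℝ e (r • (θ : E))) ^ 2) =
      Real.exp (-r ^ 2 - r ^ 2 * (B * (inner ℝ e (θ : E)) ^ 2)) := by
  congr 1
  simp only [norm_smul, norm_eq_of_mem_sphere, inner_smul_right, Real.norm_eq_abs, mul_one, sq_abs]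
  ring

/-- The Gaussian `exp (-|x|² - B ⟪e, x⟫²)` on `E` factorises in a frame containing `e`, and only one
factor depends on `B`, as `(1 + B)^(-1/2)`. In polar coordinates it dominates `exp (-B ⟪e, θ⟫²) ·
exp (-1)` on `r < 1`, because `r² ≤ 1` there. -/
theorem integral_sphere_gaussian_le [Nontrivial E] :
    ∃ C : ℝ, 0 < C ∧ ∀ (e : E) (B : ℝ), ‖e‖ = 1 → 0 ≤ B →
      ∫ θ : Metric.sphere (0 : E) 1, Real.exp (-B * (inner ℝ e (θ : E)) ^ 2)
        ∂((volume : Measure E).toSphere) ≤ C / Real.sqrt (1 + B) := by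
  set d := Module.finrank ℝ E with hd
  have hd0 : 0 < d := Module.finrank_pos
  set ν := Measure.volumeIoiPow (d - 1) with hν
  set W : ℝ := ∫ r, (Iio (⟨1, mem_Ioi.2 one_pos⟩ : Ioi (0 : ℝ))).indicator (fun _ => Real.exp (-1)) r ∂ν
    with hW
  have hWpos : 0 < W := by
    rw [hW, integral_indicator measurableSet_Iio, setIntegral_const, smul_eq_mul, Measure.real,
      Measure.volumeIoiPow_apply_Iio, ENNReal.toReal_ofReal (by positivity)]
    positivity
  set i₀ : Fin d := ⟨0, hd0⟩
  set P : ℝ := ∏ i ∈ Finset.univ.erase i₀, ∫ t, gaussianFactor i₀ 0 i t with hP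
  have hPpos : 0 < P := by
    refine Finset.prod_pos fun i hi => ?_
    simp only [gaussianFactor, (Finset.mem_erase.1 hi).1, if_false]
    rw [integral_gaussian]
    positivity
  refine ⟨Real.sqrt Real.pi * P / W, by positivity, fun e B he hB => ?_⟩
  obtain ⟨b, hb⟩ := exists_orthonormalBasis_eq hd.symm i₀ he
  set A := ∫ θ : Metric.sphere (0 : E) 1, Real.exp (-B * (inner ℝ e (θ : E)) ^ 2)
        ∂((volume : Measure E).toSphere)
  have hprod : ∏ i, ∫ t, gaussianFactor i₀ B i t = Real.sqrt Real.pi * P / Real.sqrt (1 + B) := by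
    rw [← Finset.mul_prod_erase _ _ (Finset.mem_univ i₀)]
    have h1 : ∫ t, gaussianFactor i₀ B i₀ t = Real.sqrt Real.pi / Real.sqrt (1 + B) := by
      simp only [gaussianFactor, if_true]
      rw [integral_gaussian, Real.sqrt_div Real.pi_pos.le]
    have h2 : ∏ i ∈ Finset.univ.erase i₀, ∫ t, gaussianFactor i₀ B i t = P := by
      refine Finset.prod_congr rfl fun i hi => ?_
      simp only [gaussianFactor, (Finset.mem_erase.1 hi).1, if_false]
    rw [h1, h2]
    ring
  have hint := integrable_prod_orthonormal b (integrable_gaussianFactor i₀ hB)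
  have heq := integral_prod_orthonormal b (gaussianFactor i₀ B)
  simp only [prod_gaussianFactor, hb] at hint heq
  rw [integral_polar] at heq
  have hint2 := integrable_polar hint
  simp only [gaussian_smul_sphere] at heq hint2
  have hAW : A * W ≤ ∏ i, ∫ t, gaussianFactor i₀ B i t := by
    rw [← heq, ← integral_prod_mul]
    refine integral_mono_of_nonneg (.of_forall fun p => ?_) hint2 (.of_forall fun p => ?_)
    · exact mul_nonneg (Real.exp_pos _).le (indicator_nonneg (fun _ _ => (Real.exp_pos _).le) _)
    · simp only [indicator]
      split_ifs with h
      · rw [← Real.exp_add]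
        refine Real.exp_le_exp.2 ?_
        have h1 : (p.2 : ℝ) < 1 := h
        have h0 : (0 : ℝ) < p.2 := p.2.2
        have h2 : (p.2 : ℝ) ^ 2 ≤ 1 := by nlinarith
        have h3 : 0 ≤ B * (inner ℝ e (p.1 : E)) ^ 2 := by positivity
        nlinarith
      · simp only [mul_zero]
        positivity
  rw [hprod] at hAW
  rw [← le_div_iff₀ hWpos] at hAW
  refine hAW.trans (le_of_eq ?_)
  ring

/-- The same Gaussian is restricted to a half-space `⟪b i₁, x⟫ ≥ 1` with `b i₁` orthogonal to `e`.
This forces `r ≥ 1`, hence `r² B ≥ B`, without touching the factor that carries `B`. The second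
direction is what `2 ≤ finrank` provides; on the two-point sphere of a line the integral decays
exponentially in `B`. -/
theorem le_integral_sphere_gaussian (hE : 2 ≤ Module.finrank ℝ E) :
    ∃ c : ℝ, 0 < c ∧ ∀ (e : E) (B : ℝ), ‖e‖ = 1 → 0 ≤ B →
      c / Real.sqrt (1 + B) ≤
      ∫ θ : Metric.sphere (0 : E) 1, Real.exp (-B * (inner ℝ e (θ : E)) ^ 2)
        ∂((volume : Measure E).toSphere) := by
  set d := Module.finrank ℝ E with hd
  have : Nontrivial E := Module.nontrivial_of_finrank_pos (R := ℝ) (by omega)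
  set ν := Measure.volumeIoiPow (d - 1) with hν
  set N : ℝ := ∫ r : Ioi (0 : ℝ), Real.exp (-(r : ℝ) ^ 2) ∂ν with hN
  have hN0 : 0 ≤ N := integral_nonneg fun _ => (Real.exp_pos _).le
  set i₀ : Fin d := ⟨0, by omega⟩
  set i₁ : Fin d := ⟨1, by omega⟩
  have hne : i₁ ≠ i₀ := by simp [i₀, i₁]
  set g : ℝ → Fin d → ℝ → ℝ := fun B i =>
    if i = i₁ then (Ici (1 : ℝ)).indicator (gaussianFactor i₀ B i) else gaussianFactor i₀ B i
    with hg
  have hgi : ∀ B i, 0 ≤ B → Integrable (g B i) := by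
    intro B i hB
    have := integrable_gaussianFactor i₀ hB i
    simp only [hg]
    split_ifs
    · exact this.indicator measurableSet_Ici
    · exact this
  set P : ℝ := ∏ i ∈ Finset.univ.erase i₀, ∫ t, g 0 i t with hP
  have hPpos : 0 < P := by
    refine Finset.prod_pos fun i hi => ?_
    rw [integral_pos_iff_support_of_nonneg _ (hgi 0 i le_rfl)]
    · refine lt_of_lt_of_le ?_ (measure_mono (s := Ici (1 : ℝ)) ?_)
      · simp
      · intro t ht
        have h : gaussianFactor i₀ 0 i t ≠ 0 := (Real.exp_pos _).ne'
        simp only [hg, Function.mem_support]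
        split_ifs
        · rwa [indicator_of_mem ht]
        · exact h
    · intro t
      simp only [hg]
      split_ifs
      · exact indicator_nonneg (fun _ _ => (Real.exp_pos _).le) _
      · exact (Real.exp_pos _).le
  -- Dividing by `N + 1` rather than `N` means that only `0 ≤ N` is needed.
  refine ⟨Real.sqrt Real.pi * P / (N + 1), by positivity, fun e B he hB => ?_⟩
  obtain ⟨b, hb⟩ := exists_orthonormalBasis_eq hd.symm i₀ he
  set A := ∫ θ : Metric.sphere (0 : E) 1, Real.exp (-B * (inner ℝ e (θ : E)) ^ 2)
        ∂((volume : Measure E).toSphere)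
  have hA0 : 0 ≤ A := integral_nonneg fun _ => (Real.exp_pos _).le
  have hprod : ∏ i, ∫ t, g B i t = Real.sqrt Real.pi * P / Real.sqrt (1 + B) := by
    rw [← Finset.mul_prod_erase _ _ (Finset.mem_univ i₀)]
    have h1 : ∫ t, g B i₀ t = Real.sqrt Real.pi / Real.sqrt (1 + B) := by
      simp only [hg, hne.symm, if_false, gaussianFactor, if_true]
      rw [integral_gaussian, Real.sqrt_div Real.pi_pos.le]
    have h2 : ∏ i ∈ Finset.univ.erase i₀, ∫ t, g B i t = P := by
      refine Finset.prod_congr rfl fun i hi => ?_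
      have : gaussianFactor i₀ B i = gaussianFactor i₀ 0 i := by
        funext t
        simp only [gaussianFactor, (Finset.mem_erase.1 hi).1, if_false]
      simp only [hg, this]
    rw [h1, h2]
    ring
  have heq := integral_prod_orthonormal b (g B)
  rw [integral_polar, hprod] at heq
  have hnn : ∀ x : E, 0 ≤ ∏ i, g B i (inner ℝ (b i) x) := by
    refine fun x => Finset.prod_nonneg fun i _ => ?_
    simp only [hg]
    split_ifs
    · exact indicator_nonneg (fun _ _ => (Real.exp_pos _).le) _
    · exact (Real.exp_pos _).le
  have hGint : Integrable (fun p : Metric.sphere (0 : E) 1 × Ioi (0 : ℝ) =>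
      Real.exp (-B * (inner ℝ e (p.1 : E)) ^ 2) * Real.exp (-(p.2 : ℝ) ^ 2))
      ((volume : Measure E).toSphere.prod ν) := by
    have h0 := integrable_polar
      (integrable_prod_orthonormal b (integrable_gaussianFactor i₀ le_rfl))
    simp only [prod_gaussianFactor, gaussian_smul_sphere] at h0
    refine h0.mono' (Continuous.aestronglyMeasurable (by fun_prop)) (.of_forall fun p => ?_)
    rw [Real.norm_of_nonneg (by positivity), ← Real.exp_add]
    refine Real.exp_le_exp.2 ?_
    have h3 : 0 ≤ B * (inner ℝ e (p.1 : E)) ^ 2 := by positivity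
    nlinarith
  have hAN : Real.sqrt Real.pi * P / Real.sqrt (1 + B) ≤ A * N := by
    rw [← heq, ← integral_prod_mul]
    refine integral_mono_of_nonneg (.of_forall fun p => hnn _) hGint (.of_forall fun p => ?_)
    by_cases h : 1 ≤ inner ℝ (b i₁) ((p.2 : ℝ) • (p.1 : E))
    · have h0 : (0 : ℝ) < p.2 := p.2.2
      have h1 : (1 : ℝ) ≤ p.2 := by
        refine h.trans ((real_inner_le_norm _ _).trans ?_)
        simp [norm_smul, abs_of_pos h0]
      have : ∏ i, g B i (inner ℝ (b i) ((p.2 : ℝ) • (p.1 : E))) =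
          ∏ i, gaussianFactor i₀ B i (inner ℝ (b i) ((p.2 : ℝ) • (p.1 : E))) := by
        refine Finset.prod_congr rfl fun i _ => ?_
        simp only [hg]
        split_ifs with hi
        · rw [indicator_of_mem]
          rw [hi]; exact h
        · rfl
      simp only [this, prod_gaussianFactor, hb, gaussian_smul_sphere, ← Real.exp_add]
      refine Real.exp_le_exp.2 ?_
      have h3 : 0 ≤ B * (inner ℝ e (p.1 : E)) ^ 2 := by positivity
      have h2 : 1 ≤ (p.2 : ℝ) ^ 2 := by nlinarith
      nlinarith
    · have : ∏ i, g B i (inner ℝ (b i) ((p.2 : ℝ) • (p.1 : E))) = 0 := by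
        refine Finset.prod_eq_zero (Finset.mem_univ i₁) ?_
        simp only [hg, if_true]
        exact indicator_of_notMem h _
      simp only [this]
      positivity
  have : Real.sqrt Real.pi * P / Real.sqrt (1 + B) ≤ A * (N + 1) := by linarith
  rw [← div_le_iff₀ (by positivity)] at this
  refine le_trans (le_of_eq ?_) this
  ring

end SphereGaussian

/-! ### The model oscillatory integral and its Gaussian approximation. -/

section ModelSymbol

open Complex

/-- The model oscillatory integral
`∫∫ exp (-(1 + i ξ) (s t + t²) - i q t) ψ(s) ds dt`. -/
def modelSymbol (ψ : ℝ → ℝ) (ξ q : ℝ) : ℂ :=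
  ∫ p : ℝ × ℝ, cexp (-(1 + ξ * I) * (p.1 * p.2 + p.2 ^ 2) - q * p.2 * I) * ψ p.1

/-- The quadratic form `s t + t² + s² / 2` is positive definite: it exceeds `s² / 6 + t² / 4` by
exactly `(2 s + 3 t)² / 12`. -/
theorem integrable_exp_neg_form :
    Integrable fun p : ℝ × ℝ => Real.exp (-(p.1 * p.2 + p.2 ^ 2) - p.1 ^ 2 / 2) := by
  have h := (integrable_exp_neg_mul_sq (show (0 : ℝ) < 1 / 6 by norm_num)).mul_prod
    (integrable_exp_neg_mul_sq (show (0 : ℝ) < 1 / 4 by norm_num))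
  refine h.mono' (Continuous.aestronglyMeasurable (by fun_prop)) (.of_forall fun p => ?_)
  rw [Real.norm_of_nonneg (Real.exp_pos _).le, ← Real.exp_add]
  refine Real.exp_le_exp.2 ?_
  nlinarith [sq_nonneg (2 * p.1 + 3 * p.2)]

theorem norm_cexp_model (ξ q p : ℝ) (x : ℝ × ℝ) :
    ‖cexp (-(1 + ξ * I) * (x.1 * x.2 + x.2 ^ 2) - q * x.2 * I + p * x.1 * I - x.1 ^ 2 / 2)‖ =
      Real.exp (-(x.1 * x.2 + x.2 ^ 2) - x.1 ^ 2 / 2) := by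
  rw [Complex.norm_exp]
  congr 1
  simp [pow_two]

/-- The model integral of a modulated Gaussian. -/
theorem integral_model_gaussian (ξ q p : ℝ) :
    ∫ x : ℝ × ℝ,
      cexp (-(1 + ξ * I) * (x.1 * x.2 + x.2 ^ 2) - q * x.2 * I + p * x.1 * I - x.1 ^ 2 / 2) =
      (2 * Real.pi / Real.sqrt (1 + ξ ^ 2) : ℝ) *
        cexp (-((q / Real.sqrt (1 + ξ ^ 2) : ℝ) + (1 + ξ * I) / (Real.sqrt (1 + ξ ^ 2) : ℝ) * p) ^ 2
          / 2 - p ^ 2 / 2) := by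
  have hint : Integrable fun x : ℝ × ℝ =>
      cexp (-(1 + ξ * I) * (x.1 * x.2 + x.2 ^ 2) - q * x.2 * I + p * x.1 * I - x.1 ^ 2 / 2) := by
    refine (integrable_norm_iff (Continuous.aestronglyMeasurable (by fun_prop))).1 ?_
    simpa only [norm_cexp_model] using integrable_exp_neg_form
  have hw : (0 : ℝ) < 1 + ξ ^ 2 := by positivity
  set w := Real.sqrt (1 + ξ ^ 2) with hwdef
  have hw0 : 0 < w := Real.sqrt_pos.2 hw
  have hw2 : (w : ℂ) ^ 2 = 1 + (ξ : ℂ) ^ 2 := by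
    rw [← Complex.ofReal_pow, Real.sq_sqrt hw.le]; push_cast; rfl
  have hwne : (w : ℂ) ≠ 0 := by exact_mod_cast hw0.ne'
  have hcp : ∀ r : ℝ, 0 ≤ r → (r : ℂ) ^ (1 / 2 : ℂ) = (Real.sqrt r : ℝ) := by
    intro r hr
    rw [Real.sqrt_eq_rpow, Complex.ofReal_cpow hr]
    norm_num
  rw [Measure.volume_eq_prod, integral_prod_symm _ hint]
  -- The coefficient of `t²` becomes `(1 + i ξ)² / 2 - (1 + i ξ) = -(1 + ξ²) / 2`: the imaginary
  -- parts cancel, which is the point of the Gaussian profile.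
  have inner : ∀ t : ℝ, ∫ s : ℝ,
      cexp (-(1 + ξ * I) * (s * t + t ^ 2) - q * t * I + p * s * I - s ^ 2 / 2) =
      (Real.sqrt (2 * Real.pi) : ℝ) *
        cexp (-((1 + ξ ^ 2) / 2) * t ^ 2 + (-I * (q + (1 + ξ * I) * p)) * t + (-p ^ 2 / 2)) := by
    intro t
    have h := integral_cexp_quadratic (b := -1 / 2) (by norm_num) (p * I - (1 + ξ * I) * t)
      (-(1 + ξ * I) * t ^ 2 - q * t * I)
    have e1 : (Real.pi : ℂ) / -(-1 / 2) = (2 * Real.pi : ℝ) := by push_cast; ring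
    rw [e1, hcp _ (by positivity)] at h
    rw [← h.trans (congrArg _ (congrArg cexp ?_))]
    · refine integral_congr_ae (.of_forall fun s => ?_)
      simp only
      congr 1
      ring
    · ring_nf
      simp only [I_sq]
      ring
  simp only [inner]
  rw [integral_const_mul]
  have h := integral_cexp_quadratic (b := -((1 + (ξ : ℂ) ^ 2) / 2))
    (by
      have : (-((1 + (ξ : ℂ) ^ 2) / 2)) = ((-((1 + ξ ^ 2) / 2) : ℝ) : ℂ) := by push_cast; rfl
      rw [this, Complex.ofReal_re]; linarith)
    (-I * (q + (1 + ξ * I) * p)) (-p ^ 2 / 2)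
  have e1 : (Real.pi : ℂ) / -(-((1 + (ξ : ℂ) ^ 2) / 2)) = (2 * Real.pi / (1 + ξ ^ 2) : ℝ) := by
    have : (1 + (ξ : ℂ) ^ 2) ≠ 0 := by rw [← hw2]; exact pow_ne_zero 2 hwne
    push_cast
    field_simp
  rw [e1, hcp _ (by positivity)] at h
  rw [h, ← mul_assoc]
  congr 1
  · rw [← Complex.ofReal_mul, Real.sqrt_div (by positivity), ← hwdef, ← mul_div_assoc,
      Real.mul_self_sqrt (by positivity)]
  · congr 1
    rw [← hw2]
    push_cast
    field_simp
    have h3 : I ^ 3 = -I := I_pow_three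
    have h4 : I ^ 4 = 1 := I_pow_four
    ring_nf
    simp only [I_sq, h3, h4]
    ring

/-- Comparison of a complex-shifted Gaussian with the unshifted one. -/
theorem norm_gaussian_shift_sub_le (u p : ℝ) {ζ : ℂ} (hζ : ‖ζ‖ = 1) :
    ‖cexp (-(u + ζ * p) ^ 2 / 2 - p ^ 2 / 2) - Real.exp (-u ^ 2 / 2)‖ ≤
      2 * (|p| + p ^ 2) * Real.exp (-u ^ 2 / 8) := by
  -- Interpolation from the unshifted Gaussian at `t = 0` to the shifted one at `t = 1`, to be
  -- combined with the mean value inequality.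
  set f : ℝ → ℂ := fun t => cexp (-(u + ζ * (t * p)) ^ 2 / 2 - (t * p) ^ 2 / 2) with hf
  have hζ2 : ζ.re ^ 2 + ζ.im ^ 2 = 1 := by
    have := Complex.sq_norm ζ
    rw [hζ, Complex.normSq_apply] at this
    nlinarith
  -- Because `|ζ| = 1`, the term `-(t p)² / 2` outweighs the growth from `Im ζ`. What remains is
  -- `-((u + a)² + a²) / 2` with `a = Re ζ · t p`, which is at most `-u² / 4`.
  have hnorm : ∀ t, ‖f t‖ ≤ Real.exp (-u ^ 2 / 4) := by
    intro t
    rw [hf, Complex.norm_exp]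
    refine Real.exp_le_exp.2 ?_
    have : (-((u : ℂ) + ζ * (t * p)) ^ 2 / 2 - (t * p) ^ 2 / 2).re =
        -((u + ζ.re * (t * p)) ^ 2 - (ζ.im * (t * p)) ^ 2) / 2 - (t * p) ^ 2 / 2 := by
      simp [pow_two, -neg_add_rev]
    rw [this]
    have h2 : (t * p) ^ 2 = (ζ.re ^ 2 + ζ.im ^ 2) * (t * p) ^ 2 := by rw [hζ2, one_mul]
    rw [h2]
    nlinarith [sq_nonneg (u + 2 * ζ.re * (t * p))]
  have hderiv : ∀ t : ℝ, HasDerivAt f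
      (cexp (-(u + ζ * (t * p)) ^ 2 / 2 - (t * p) ^ 2 / 2) *
        (-(u + ζ * (t * p)) * (ζ * p) - t * p * p)) t := by
    intro t
    have h0 : HasDerivAt (fun t : ℝ => (t : ℂ) * p) (p : ℂ) t := by
      simpa using (Complex.ofRealCLM.hasDerivAt (x := t)).mul_const (p : ℂ)
    have h1 := ((((h0.const_mul ζ).const_add (u : ℂ)).pow 2).neg.div_const 2).sub
      ((h0.pow 2).div_const 2)
    refine h1.cexp.congr_deriv (congrArg₂ (· * ·) rfl ?_)
    push_cast
    ring
  have hb : ∀ t ∈ Ico (0 : ℝ) 1, ‖cexp (-(u + ζ * (t * p)) ^ 2 / 2 - (t * p) ^ 2 / 2) *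
        (-(u + ζ * (t * p)) * (ζ * p) - t * p * p)‖ ≤
        Real.exp (-u ^ 2 / 4) * (|u| * |p| + 2 * p ^ 2) := by
    intro t ht
    rw [norm_mul]
    refine mul_le_mul (hnorm t) ?_ (norm_nonneg _) (Real.exp_pos _).le
    have ht1 : |t| ≤ 1 := by rw [abs_of_nonneg ht.1]; exact ht.2.le
    calc _ ≤ ‖-((u : ℂ) + ζ * (t * p)) * (ζ * p)‖ + ‖(t : ℂ) * p * p‖ := norm_sub_le _ _
      _ ≤ (|u| + |t| * |p|) * |p| + |t| * |p| * |p| := by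
        refine add_le_add ?_ ?_
        · rw [norm_mul, norm_neg, norm_mul, hζ, one_mul, Complex.norm_real, Real.norm_eq_abs]
          refine mul_le_mul_of_nonneg_right ((norm_add_le _ _).trans ?_) (abs_nonneg _)
          simp [hζ]
        · simp
      _ ≤ |u| * |p| + 2 * p ^ 2 := by
        rw [← sq_abs p]
        nlinarith [mul_le_mul_of_nonneg_right ht1 (sq_nonneg |p|)]
  have hmv := norm_image_sub_le_of_norm_deriv_le_segment_01'
    (fun t _ => (hderiv t).hasDerivWithinAt) hb
  have e1 : f 1 = cexp (-(u + ζ * p) ^ 2 / 2 - p ^ 2 / 2) := by simp [hf]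
  have e0 : f 0 = Real.exp (-u ^ 2 / 2) := by simp [hf]
  rw [e1, e0] at hmv
  refine hmv.trans ?_
  -- Half of the decay is spent on the factor `|u|` produced by the derivative, which explains the
  -- final exponent `-u² / 8`.
  have hE : Real.exp (-u ^ 2 / 4) = Real.exp (-u ^ 2 / 8) * Real.exp (-u ^ 2 / 8) := by
    rw [← Real.exp_add]; congr 1; ring
  have hu : Real.exp (-u ^ 2 / 8) * |u| ≤ 2 := by
    have h1 : u ^ 2 / 8 + 1 ≤ Real.exp (u ^ 2 / 8) := Real.add_one_le_exp _
    have h2 : Real.exp (-u ^ 2 / 8) * Real.exp (u ^ 2 / 8) = 1 := by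
      rw [← Real.exp_add]; simp; ring
    have h3 : |u| ≤ 2 * Real.exp (u ^ 2 / 8) := by
      rw [← sq_abs] at h1 ⊢
      nlinarith [sq_nonneg (|u| - 2)]
    nlinarith [Real.exp_pos (-u ^ 2 / 8)]
  have hle : Real.exp (-u ^ 2 / 8) ≤ 1 := Real.exp_le_one_iff.2 (by nlinarith [sq_nonneg u])
  have hpos := Real.exp_pos (-u ^ 2 / 8)
  have hsum : Real.exp (-u ^ 2 / 8) * (|u| * |p| + 2 * p ^ 2) ≤ 2 * (|p| + p ^ 2) := by
    nlinarith [abs_nonneg p, sq_nonneg p, mul_le_mul_of_nonneg_right hu (abs_nonneg p),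
      mul_le_mul_of_nonneg_right hle (sq_nonneg p)]
  rw [hE, mul_assoc, mul_comm]
  exact mul_le_mul_of_nonneg_right hsum hpos.le

/-- A smooth bump function is a superposition of plane waves with rapidly decreasing weight. -/
theorem exists_bump_eq_integral_exp :
    ∃ (κ : ℝ → ℝ) (m : ℝ → ℂ), ContDiff ℝ ∞ κ ∧ (∀ s, 2 ≤ |s| → κ s = 0) ∧ (∀ s, 0 ≤ κ s) ∧
      κ 0 = 1 ∧ Integrable m ∧ (∀ k : ℕ, Integrable fun v => |v| ^ k * ‖m v‖) ∧
      ∀ s : ℝ, (κ s : ℂ) = ∫ v : ℝ, m v * cexp (2 * Real.pi * v * s * I) := by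
  let b : ContDiffBump (0 : ℝ) := ⟨1, 2, one_pos, by norm_num⟩
  have hs : HasCompactSupport (fun s => ((b s : ℝ) : ℂ)) :=
    b.hasCompactSupport.comp_left (g := fun r : ℝ => (r : ℂ)) Complex.ofReal_zero
  have hc : ContDiff ℝ ∞ (fun s => ((b s : ℝ) : ℂ)) := Complex.ofRealCLM.contDiff.comp b.contDiff
  let B := hs.toSchwartzMap hc
  refine ⟨b, FourierTransform.fourier B, b.contDiff, fun s hs => b.zero_of_le_dist (by simpa using hs),
    fun s => b.nonneg, b.one_of_mem_closedBall (by simp [b.rIn_pos.le]), SchwartzMap.integrable _,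
    fun k => SchwartzMap.integrable_pow_mul volume (FourierTransform.fourier B) k, fun s => ?_⟩
  have h : FourierTransformInv.fourierInv (FourierTransform.fourier B) = B :=
    FourierTransform.fourierInv_fourier_eq B
  have h2 : (FourierTransformInv.fourierInv (FourierTransform.fourier B)) s = (b s : ℂ) := by
    rw [h]; rfl
  rw [← h2, SchwartzMap.fourierInv_coe, Real.fourierInv_eq']
  refine integral_congr_ae (.of_forall fun v => ?_)
  simp [smul_eq_mul, mul_comm, mul_assoc, mul_left_comm]

/-- The profile is `exp (-s² / 2) κ (s / k)`. Expanding `κ` in plane waves modulates the Gaussian by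
frequencies `p = 2π v / k`, each of which costs `O(|p| + p²)`; integration over `v` gives `O(1 /
k)`. The error must decay in `q / w` like the main term, since a merely uniform bound would not be
absorbed after integration over the sphere. -/
theorem exists_modelSymbol_approx {ε : ℝ} (hε : 0 < ε) :
    ∃ ψ : ℝ → ℝ, ContDiff ℝ ∞ ψ ∧ (∃ R, ∀ s, R < |s| → ψ s = 0) ∧ (∀ s, 0 ≤ ψ s) ∧ ψ 0 = 1 ∧
      ∀ ξ q : ℝ, ‖modelSymbol ψ ξ q -
        (2 * Real.pi / Real.sqrt (1 + ξ ^ 2) * Real.exp (-(q / Real.sqrt (1 + ξ ^ 2)) ^ 2 / 2) : ℝ)‖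
        ≤ 2 * Real.pi / Real.sqrt (1 + ξ ^ 2) *
          (ε * Real.exp (-(q / Real.sqrt (1 + ξ ^ 2)) ^ 2 / 8)) := by
  obtain ⟨κ, m, hκ, hκs, hκ0, hκ1, hm, hmk, hκm⟩ := exists_bump_eq_integral_exp
  set D : ℝ → ℝ := fun v => 2 * (2 * Real.pi * |v| + (2 * Real.pi) ^ 2 * |v| ^ 2) * ‖m v‖ with hD
  have hDi : Integrable D := by
    have h := (((hmk 1).const_mul (2 * (2 * Real.pi))).add
      ((hmk 2).const_mul (2 * (2 * Real.pi) ^ 2)))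
    refine h.congr (.of_forall fun v => ?_)
    simp only [hD, Pi.add_apply]
    ring
  set M := ∫ v, D v with hM
  have hM0 : 0 ≤ M := integral_nonneg fun v => by simp only [hD]; positivity
  -- This makes `M / k ≤ ε`, and also `k ≥ 1`, so that the quadratic term `1 / k²` is bounded by `1
  -- / k`.
  set k : ℝ := M / ε + 1 with hk
  have hk1 : 1 ≤ k := by rw [hk]; have := div_nonneg hM0 hε.le; linarith
  have hk0 : 0 < k := by linarith
  have hMk : M / k ≤ ε := by
    rw [div_le_iff₀ hk0, hk, mul_add, mul_div_cancel₀ _ hε.ne']; linarith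
  refine ⟨fun s => Real.exp (-s ^ 2 / 2) * κ (s / k), ?_, ⟨2 * k, fun s hs => ?_⟩,
    fun s => mul_nonneg (Real.exp_pos _).le (hκ0 _), by simp [hκ1], fun ξ q => ?_⟩
  · exact (by fun_prop : ContDiff ℝ ∞ fun s : ℝ => Real.exp (-s ^ 2 / 2)).mul
      (hκ.comp (contDiff_id.div_const k))
  · simp only
    rw [hκs, mul_zero]
    rw [abs_div, abs_of_pos hk0, le_div_iff₀ hk0]
    exact hs.le
  set w := Real.sqrt (1 + ξ ^ 2) with hw
  have hwp : 0 < w := Real.sqrt_pos.2 (by positivity)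
  set u := q / w with hu
  set ζ : ℂ := (1 + ξ * I) / (w : ℝ) with hζ
  have hζ1 : ‖ζ‖ = 1 := by
    have h1 : ‖(1 + ξ * I : ℂ)‖ = w := by
      rw [Complex.norm_eq_sqrt_sq_add_sq, hw]; simp
    rw [hζ, norm_div, h1, Complex.norm_real, Real.norm_of_nonneg hwp.le, div_self hwp.ne']
  set H : ℝ → ℝ × ℝ → ℂ := fun p x =>
    cexp (-(1 + ξ * I) * (x.1 * x.2 + x.2 ^ 2) - q * x.2 * I + p * x.1 * I - x.1 ^ 2 / 2) with hH
  have hrep : modelSymbol (fun s => Real.exp (-s ^ 2 / 2) * κ (s / k)) ξ q =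
      ∫ v : ℝ, m v * ((2 * Real.pi / w : ℝ) *
        cexp (-(u + ζ * (2 * Real.pi * v / k : ℝ)) ^ 2 / 2 - (2 * Real.pi * v / k : ℝ) ^ 2 / 2)) := by
    have e1 : ∀ x : ℝ × ℝ,
        cexp (-(1 + ξ * I) * (x.1 * x.2 + x.2 ^ 2) - q * x.2 * I) *
          ((Real.exp (-x.1 ^ 2 / 2) * κ (x.1 / k) : ℝ) : ℂ) =
        ∫ v : ℝ, m v * H (2 * Real.pi * v / k) x := by
      intro x
      rw [Complex.ofReal_mul, hκm, ← mul_assoc, ← integral_const_mul]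
      refine integral_congr_ae (.of_forall fun v => ?_)
      simp only [hH]
      rw [Complex.ofReal_exp, ← Complex.exp_add, mul_left_comm, ← Complex.exp_add]
      congr 2
      push_cast
      ring
    simp only [modelSymbol, e1]
    rw [integral_integral_swap]
    · refine integral_congr_ae (.of_forall fun v => ?_)
      simp only [hH]
      rw [integral_const_mul, integral_model_gaussian]
    · have hb := integrable_exp_neg_form.mul_prod hm.norm
      have hsm : AEStronglyMeasurable
          (Function.uncurry fun (x : ℝ × ℝ) (v : ℝ) => m v * H (2 * Real.pi * v / k) x)
          ((volume : Measure (ℝ × ℝ)).prod volume) := by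
        refine hm.aestronglyMeasurable.comp_snd.mul (Continuous.aestronglyMeasurable ?_)
        simp only [hH]
        fun_prop
      refine hb.mono' hsm (.of_forall fun p => ?_)
      simp only [Function.uncurry, hH, norm_mul, norm_cexp_model]
      rw [mul_comm]
  -- The total weight is `κ 0`, so the unmodulated Gaussian enters with coefficient one.
  have hmint : ∫ v, m v = 1 := by
    have := hκm 0
    simpa [hκ1] using this.symm
  have hmain : ((2 * Real.pi / w * Real.exp (-u ^ 2 / 2) : ℝ) : ℂ) =
      ∫ v : ℝ, m v * ((2 * Real.pi / w : ℝ) * (Real.exp (-u ^ 2 / 2) : ℝ)) := by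
    rw [integral_mul_const, hmint, one_mul, Complex.ofReal_mul]
  have hbd : ∀ v : ℝ, ‖cexp (-(u + ζ * (2 * Real.pi * v / k : ℝ)) ^ 2 / 2 -
      (2 * Real.pi * v / k : ℝ) ^ 2 / 2) - (Real.exp (-u ^ 2 / 2) : ℝ)‖ * ‖m v‖ ≤
      D v / k * Real.exp (-u ^ 2 / 8) := by
    intro v
    refine (mul_le_mul_of_nonneg_right (norm_gaussian_shift_sub_le u _ hζ1)
      (norm_nonneg _)).trans ?_
    have hp : |2 * Real.pi * v / k| = 2 * Real.pi * |v| / k := by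
      rw [abs_div, abs_mul, abs_of_pos hk0, abs_of_pos (by positivity : 0 < 2 * Real.pi)]
    have hp2 : (2 * Real.pi * v / k) ^ 2 ≤ (2 * Real.pi) ^ 2 * |v| ^ 2 / k := by
      rw [div_pow, mul_pow, sq_abs]
      refine div_le_div_of_nonneg_left (by positivity) hk0 ?_
      nlinarith
    rw [hp]
    have : 2 * (2 * Real.pi * |v| / k + (2 * Real.pi * v / k) ^ 2) ≤
        2 * (2 * Real.pi * |v| + (2 * Real.pi) ^ 2 * |v| ^ 2) / k := by
      calc _ ≤ 2 * (2 * Real.pi * |v| / k + (2 * Real.pi) ^ 2 * |v| ^ 2 / k) := by linarith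
        _ = _ := by ring
    calc _ ≤ 2 * (2 * Real.pi * |v| + (2 * Real.pi) ^ 2 * |v| ^ 2) / k * Real.exp (-u ^ 2 / 8) *
          ‖m v‖ := by gcongr
      _ = _ := by simp only [hD]; ring
  have hgm : AEStronglyMeasurable (fun v : ℝ => cexp (-(u + ζ * (2 * Real.pi * v / k : ℝ)) ^ 2 / 2 -
      (2 * Real.pi * v / k : ℝ) ^ 2 / 2) - (Real.exp (-u ^ 2 / 2) : ℝ)) volume :=
    Continuous.aestronglyMeasurable (by fun_prop)
  have hdi : Integrable fun v : ℝ => m v * (cexp (-(u + ζ * (2 * Real.pi * v / k : ℝ)) ^ 2 / 2 -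
      (2 * Real.pi * v / k : ℝ) ^ 2 / 2) - (Real.exp (-u ^ 2 / 2) : ℝ)) := by
    refine ((hDi.div_const k).mul_const (Real.exp (-u ^ 2 / 8))).mono'
      (hm.aestronglyMeasurable.mul hgm) (.of_forall fun v => ?_)
    rw [norm_mul, mul_comm]
    exact hbd v
  have hei : Integrable fun v : ℝ => m v * ((2 * Real.pi / w : ℝ) * (Real.exp (-u ^ 2 / 2) : ℝ) : ℂ) :=
    hm.mul_const _
  have hsplit : ∀ v : ℝ, m v * ((2 * Real.pi / w : ℝ) *
        cexp (-(u + ζ * (2 * Real.pi * v / k : ℝ)) ^ 2 / 2 - (2 * Real.pi * v / k : ℝ) ^ 2 / 2)) =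
      (2 * Real.pi / w : ℝ) * (m v * (cexp (-(u + ζ * (2 * Real.pi * v / k : ℝ)) ^ 2 / 2 -
      (2 * Real.pi * v / k : ℝ) ^ 2 / 2) - (Real.exp (-u ^ 2 / 2) : ℝ))) +
      m v * ((2 * Real.pi / w : ℝ) * (Real.exp (-u ^ 2 / 2) : ℝ)) := by
    intro v; ring
  rw [hrep, hmain, integral_congr_ae (.of_forall hsplit),
    integral_add (hdi.const_mul _) hei, add_sub_cancel_right, integral_const_mul, norm_mul,
    Complex.norm_real, Real.norm_of_nonneg (by positivity)]
  refine mul_le_mul_of_nonneg_left ?_ (by positivity)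
  calc _ ≤ ∫ v, D v / k * Real.exp (-u ^ 2 / 8) := by
        refine norm_integral_le_of_norm_le ((hDi.div_const k).mul_const _) (.of_forall fun v => ?_)
        rw [norm_mul, mul_comm]
        exact hbd v
    _ = M / k * Real.exp (-u ^ 2 / 8) := by rw [integral_mul_const, integral_div]
    _ ≤ _ := by gcongr

end ModelSymbol

/-! ### Continuity and bounds for cutoffs at a fixed base point. -/

section Cutoff

variable {n : ℕ} {K : Set (Tang n)}

/-- The unit sphere of the tangential space. -/
abbrev Sph (n : ℕ) : Type := Metric.sphere (0 : Tang n) 1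

theorem IsCutoff.continuous_slice {χ : ℝ → Tang n → Tang n → ℝ} (hχ : IsCutoff K χ) {y : Tang n}
    (hy : y ∈ K) : Continuous fun p : ℝ × Sph n => χ p.1 y p.2 := by
  obtain ⟨V, -, hKV, hs, -⟩ := hχ
  exact hs.continuousOn.comp_continuous (f := fun p : ℝ × Sph n => (p.1, y, (p.2 : Tang n)))
    (by fun_prop) fun p => ⟨mem_univ _, hKV hy, p.2.2⟩

theorem IsCutoff.exists_bound {χ : ℝ → Tang n → Tang n → ℝ} (hχ : IsCutoff K χ) {y : Tang n}
    (hy : y ∈ K) : ∃ R M : ℝ, 0 ≤ R ∧ 0 ≤ M ∧ (∀ s (θ : Sph n), R < |s| → χ s y θ = 0) ∧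
      ∀ s (θ : Sph n), |χ s y θ| ≤ M := by
  have hc := hχ.continuous_slice hy
  obtain ⟨V, -, hKV, -, R, hR⟩ := hχ
  obtain ⟨M, hM⟩ := ((isCompact_Icc (a := -R) (b := R)).prod
    (isCompact_univ (X := Sph n))).exists_bound_of_continuousOn hc.continuousOn
  refine ⟨max R 0, max M 0, le_max_right _ _, le_max_right _ _,
    fun s θ h => hR s y (hKV hy) θ θ.2 (lt_of_le_of_lt (le_max_left _ _) h), fun s θ => ?_⟩
  by_cases h : R < |s|
  · rw [hR s y (hKV hy) θ θ.2 h, abs_zero]; exact le_max_right _ _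
  · exact (hM (s, θ) ⟨abs_le.1 (not_lt.1 h), mem_univ _⟩).trans (le_max_left _ _)

end Cutoff

/-! ### Taylor expansion of the curves. -/

namespace CurveFamily

variable {n : ℕ} {K : Set (Tang n)} (𝒢 : CurveFamily n K)

theorem mem_paramDomain_zero {y : Tang n} (hy : ((0 : ℝ), y) ∈ 𝒢.U) (θ : Sph n) :
    ((0 : ℝ), y, (0 : ℝ), (θ : Tang n), (0 : ℝ)) ∈ paramDomain n 𝒢.U 𝒢.δ₀ :=
  ⟨hy, by simpa using 𝒢.δ₀_pos, θ.2, by simpa using 𝒢.δ₀_pos⟩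

theorem continuous_accel {y : Tang n} (hy : ((0 : ℝ), y) ∈ 𝒢.U) :
    Continuous fun θ : Sph n => 𝒢.α 0 y 0 θ 0 :=
  𝒢.smooth_α.continuousOn.comp_continuous
    (f := fun θ : Sph n => ((0 : ℝ), y, (0 : ℝ), (θ : Tang n), (0 : ℝ))) (by fun_prop)
    (𝒢.mem_paramDomain_zero hy)

/-- Second-order Taylor expansion of the curves, tested against a linear functional. -/
theorem exists_taylor (L : ℝ × Tang n →L[ℝ] ℝ) {x : ℝ} {y : Tang n} {l : ℝ} {θ : Tang n} {t : ℝ}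
    (h : (x, y, l, θ, t) ∈ paramDomain n 𝒢.U 𝒢.δ₀) :
    ∃ r : ℝ, |r| ≤ |t| ∧ L (𝒢.γ x y l θ t) =
      L (x, y) + t * L (l, θ) + t ^ 2 * L (𝒢.α x y l θ r, 𝒢.β x y l θ r) := by
  obtain ⟨hU, hl, hθ, ht⟩ := h
  simp only at hU hl hθ ht
  rcases eq_or_ne t 0 with rfl | ht0
  · exact ⟨0, le_rfl, by simp [𝒢.position x y l θ hU hl hθ]⟩
  have hγ : ContDiffOn ℝ ∞ (𝒢.γ x y l θ) (Ioo (-𝒢.δ₀) 𝒢.δ₀) :=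
    𝒢.smooth_γ.comp (f := fun t : ℝ => (x, y, l, θ, t)) (by fun_prop)
      fun t ht => ⟨hU, hl, hθ, abs_lt.2 ht⟩
  have hsub : uIcc 0 t ⊆ Ioo (-𝒢.δ₀) 𝒢.δ₀ := by
    intro r hr
    refine abs_lt.1 (lt_of_le_of_lt ?_ ht)
    simpa using abs_sub_left_of_mem_uIcc hr
  have hLγ : ContDiffOn ℝ ∞ (fun t => L (𝒢.γ x y l θ t)) (Ioo (-𝒢.δ₀) 𝒢.δ₀) :=
    L.contDiff.comp_contDiffOn hγ
  -- The Lagrange remainder with a single intermediate point is a scalar statement, hence the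
  -- functional `L`. Its factor `1 / 2!` cancels the `2` in the acceleration.
  obtain ⟨r, hr, h⟩ := taylor_mean_remainder_lagrange_iteratedDeriv (n := 1) ht0.symm
    ((hLγ.mono hsub).of_le (WithTop.coe_le_coe.2 (le_top : ((1 : ℕ) : ℕ∞) + 1 ≤ ⊤)))
  have hr' : r ∈ uIcc 0 t := uIoo_subset_uIcc_self hr
  have hrI := hsub hr'
  refine ⟨r, by simpa using abs_sub_left_of_mem_uIcc hr', ?_⟩
  have hd : derivWithin (fun t => L (𝒢.γ x y l θ t)) (uIcc 0 t) 0 = L (l, θ) := by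
    have h1 := L.hasFDerivAt.comp_hasDerivAt 0 (𝒢.velocity x y l θ hU hl hθ)
    exact h1.hasDerivWithinAt.derivWithin (uniqueDiffOn_uIcc ht0.symm 0 left_mem_uIcc)
  have h2 : iteratedDeriv 2 (fun t => L (𝒢.γ x y l θ t)) r =
      2 * L (𝒢.α x y l θ r, 𝒢.β x y l θ r) := by
    have hat : ContDiffAt ℝ ∞ (𝒢.γ x y l θ) r := hγ.contDiffAt (isOpen_Ioo.mem_nhds hrI)
    have h3 := L.iteratedFDeriv_comp_left hat (i := 2)
      (WithTop.coe_le_coe.2 (le_top : ((2 : ℕ) : ℕ∞) ≤ ⊤))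
    have h4 := congrArg (fun m => m fun _ => (1 : ℝ)) h3
    have h5 : iteratedDeriv 2 (fun t => L (𝒢.γ x y l θ t)) r =
        L (iteratedDeriv 2 (𝒢.γ x y l θ) r) := h4
    rw [h5, 𝒢.acceleration x y l θ r ⟨hU, hl, hθ, abs_lt.2 hrI⟩, map_smul, smul_eq_mul]
  rw [taylorWithinEval_succ, taylor_within_zero_eval, iteratedDerivWithin_one, hd] at h
  norm_num at h
  rw [h2, 𝒢.position x y l θ hU hl hθ] at h
  linear_combination h

end CurveFamily

/-! ### The front-face kernel in the coordinates `(s, θ, t)`. -/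

namespace CurveFamily

variable {n : ℕ} {K : Set (Tang n)} (𝒢 : CurveFamily n K)

/-- The product of Lebesgue measure, the surface measure of the sphere and Lebesgue measure. -/
abbrev rayMeasure (n : ℕ) : Measure (ℝ × (Sph n × ℝ)) :=
  (volume : Measure ℝ).prod ((volume : Measure (Tang n)).toSphere.prod volume)

/-- The kernel on the front face, multiplied by `h`, in the coordinates `(s, θ, t)` with
`X = s t + α t²`, `Y = t θ`. -/
def pulledKernel (χ : ℝ → Tang n → Tang n → ℝ) (F : ℝ) (y : Tang n) (h : ℝ × Tang n → ℂ)
    (p : ℝ × (Sph n × ℝ)) : ℂ :=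
  ((Real.exp (-F * (p.1 * p.2.2 + 𝒢.α 0 y 0 p.2.1 0 * p.2.2 ^ 2)) * χ p.1 y p.2.1 : ℝ) : ℂ) *
    h (p.1 * p.2.2 + 𝒢.α 0 y 0 p.2.1 0 * p.2.2 ^ 2, p.2.2 • (p.2.1 : Tang n))

/-- On the support of `χ` one has `|s| ≤ R`, so `s t + α t² ≥ C t² / 2 - R² / (2 C)` and the factor
`exp (-F X)` is a Gaussian in `t`. Allowing any bounded continuous `h` covers both test functions
and plane waves. -/
theorem integrable_pulledKernel {χ : ℝ → Tang n → Tang n → ℝ} (hχ : IsCutoff K χ) {F : ℝ}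
    (hF : 0 < F) {y : Tang n} (hy : y ∈ K) {h : ℝ × Tang n → ℂ} (hh : Continuous h) {H : ℝ}
    (hH : ∀ w, ‖h w‖ ≤ H) : Integrable (𝒢.pulledKernel χ F y h) (rayMeasure n) := by
  obtain ⟨C, hC, hCα⟩ := 𝒢.convex
  obtain ⟨R, M, hR, hM, hχR, hχM⟩ := hχ.exists_bound hy
  have hα := 𝒢.continuous_accel (𝒢.mem_U y hy)
  have hα' : Continuous fun p : ℝ × (Sph n × ℝ) => 𝒢.α 0 y 0 p.2.1 0 :=
    hα.comp (continuous_fst.comp continuous_snd)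
  have hχ' : Continuous fun p : ℝ × (Sph n × ℝ) => χ p.1 y p.2.1 :=
    (hχ.continuous_slice hy).comp (continuous_fst.prodMk (continuous_fst.comp continuous_snd))
  have hcont : Continuous (𝒢.pulledKernel χ F y h) := by
    unfold pulledKernel
    have hX : Continuous fun p : ℝ × (Sph n × ℝ) =>
        p.1 * p.2.2 + 𝒢.α 0 y 0 p.2.1 0 * p.2.2 ^ 2 :=
      (by fun_prop : Continuous fun p : ℝ × (Sph n × ℝ) => p.1 * p.2.2).add
        (hα'.mul (by fun_prop))
    exact (Complex.continuous_ofReal.comp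
      ((Real.continuous_exp.comp (continuous_const.mul hX)).mul hχ')).mul
      (hh.comp (hX.prodMk (by fun_prop)))
  have hb : Integrable (fun p : ℝ × (Sph n × ℝ) => (Icc (-R) R).indicator (fun _ => (1 : ℝ)) p.1 *
      (1 * Real.exp (-(F * C / 2) * p.2.2 ^ 2))) (rayMeasure n) := by
    refine Integrable.mul_prod (f := (Icc (-R) R).indicator fun _ => (1 : ℝ))
      (g := fun q : Sph n × ℝ => 1 * Real.exp (-(F * C / 2) * q.2 ^ 2)) ?_ ?_
    · exact (integrable_indicator_iff measurableSet_Icc).2 (by simp)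
    · exact Integrable.mul_prod (f := fun _ : Sph n => (1 : ℝ)) (integrable_const 1)
        (integrable_exp_neg_mul_sq (by positivity))
  refine (hb.const_mul (Real.exp (F * R ^ 2 / (2 * C)) * M * H)).mono'
    hcont.aestronglyMeasurable (.of_forall fun p => ?_)
  have hH0 : 0 ≤ H := (norm_nonneg _).trans (hH 0)
  simp only [pulledKernel, norm_mul, Complex.norm_real, Real.norm_eq_abs, Real.abs_exp]
  by_cases hs : R < |p.1|
  · rw [hχR _ _ hs]
    simp only [abs_zero, mul_zero, zero_mul]
    refine mul_nonneg (by positivity) (mul_nonneg (indicator_nonneg (fun _ _ => zero_le_one) _)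
      (by positivity))
  · rw [indicator_of_mem (mem_Icc.2 (abs_le.1 (not_lt.1 hs)))]
    have h1 := hCα 0 y 0 p.2.1 0 (𝒢.mem_paramDomain_zero (𝒢.mem_U y hy) p.2.1)
    have h2 : Real.exp (-F * (p.1 * p.2.2 + 𝒢.α 0 y 0 p.2.1 0 * p.2.2 ^ 2)) ≤
        Real.exp (F * R ^ 2 / (2 * C)) * Real.exp (-(F * C / 2) * p.2.2 ^ 2) := by
      rw [← Real.exp_add]
      refine Real.exp_le_exp.2 ?_
      have h3 : -(R * |p.2.2|) ≤ p.1 * p.2.2 := by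
        refine (neg_le_neg ?_).trans (neg_abs_le _)
        rw [abs_mul]
        exact mul_le_mul_of_nonneg_right (not_lt.1 hs) (abs_nonneg _)
      have h4 : R * |p.2.2| ≤ C * p.2.2 ^ 2 / 2 + R ^ 2 / (2 * C) := by
        have h5 : C * p.2.2 ^ 2 / 2 + R ^ 2 / (2 * C) - R * |p.2.2| =
            (C * |p.2.2| - R) ^ 2 / (2 * C) := by
          rw [← sq_abs p.2.2]
          field_simp
          ring
        have : 0 ≤ (C * |p.2.2| - R) ^ 2 / (2 * C) := by positivity
        linarith
      have h6 : C * p.2.2 ^ 2 ≤ 𝒢.α 0 y 0 p.2.1 0 * p.2.2 ^ 2 :=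
        mul_le_mul_of_nonneg_right h1 (sq_nonneg _)
      have h7 : -(C * p.2.2 ^ 2 / 2 + R ^ 2 / (2 * C)) + C * p.2.2 ^ 2 ≤
          p.1 * p.2.2 + 𝒢.α 0 y 0 p.2.1 0 * p.2.2 ^ 2 := by linarith
      have h8 := mul_le_mul_of_nonneg_left h7 hF.le
      have h9 : F * R ^ 2 / (2 * C) = F * (R ^ 2 / (2 * C)) := by ring
      rw [h9]
      linarith
    calc _ ≤ Real.exp (F * R ^ 2 / (2 * C)) * Real.exp (-(F * C / 2) * p.2.2 ^ 2) * M * H := by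
          gcongr
          · exact hχM _ _
          · exact hH _
      _ = _ := by ring

/-- Integrals against the front face kernel in the coordinates `(s, θ, t)`. -/
theorem integral_boundaryKernel_mul (hn : 3 ≤ n) {χ : ℝ → Tang n → Tang n → ℝ}
    (hχ : IsCutoff K χ) {F : ℝ} (hF : 0 < F) {y : Tang n} (hy : y ∈ K) {h : ℝ × Tang n → ℂ}
    (hh : Continuous h) {H : ℝ} (hH : ∀ w, ‖h w‖ ≤ H) :
    Integrable (fun w => boundaryKernel 𝒢 χ F y w * h w) ∧
      ∫ w, boundaryKernel 𝒢 χ F y w * h w = ∫ p, 𝒢.pulledKernel χ F y h p ∂(rayMeasure n) := by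
  have hd : Module.finrank ℝ (Tang n) = n - 1 := by simp
  have : Nontrivial (Tang n) := Module.nontrivial_of_finrank_pos (R := ℝ) (by omega)
  -- The Jacobian `r^(n-1)` cancels the singular factor of the kernel.
  have hpow : ∀ r : ℝ, 0 < r → r ^ (n - 1) * r ^ (1 - (n : ℤ)) = 1 := by
    intro r hr
    rw [← zpow_natCast, ← zpow_add₀ hr.ne']
    have : ((n - 1 : ℕ) : ℤ) + (1 - (n : ℤ)) = 0 := by omega
    rw [this, zpow_zero]
  -- `f₁` and `f₂` are the two summands of the kernel, coming from `t > 0` and `t < 0` respectively.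
  have key := integral_two_sided (volume : Measure (Tang n))
    (a := fun θ : Sph n => 𝒢.α 0 y 0 θ 0) (𝒢.continuous_accel (𝒢.mem_U y hy)).measurable
    (𝒢.integrable_pulledKernel hχ hF hy hh hH)
    (f₁ := fun w => ((Real.exp (-F * w.1) * ‖w.2‖ ^ (1 - (n : ℤ)) *
      χ ((w.1 - 𝒢.α 0 y 0 (‖w.2‖⁻¹ • w.2) 0 * ‖w.2‖ ^ 2) / ‖w.2‖) y (‖w.2‖⁻¹ • w.2) : ℝ) : ℂ) * h w)
    (f₂ := fun w => ((Real.exp (-F * w.1) * ‖w.2‖ ^ (1 - (n : ℤ)) *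
      χ ((-w.1 + 𝒢.α 0 y 0 (-(‖w.2‖⁻¹ • w.2)) 0 * ‖w.2‖ ^ 2) / ‖w.2‖) y
        (-(‖w.2‖⁻¹ • w.2)) : ℝ) : ℂ) * h w) ?_ ?_
  · have e : (fun w => boundaryKernel 𝒢 χ F y w * h w) = _ := funext fun w => (?_ :
        boundaryKernel 𝒢 χ F y w * h w =
          ((Real.exp (-F * w.1) * ‖w.2‖ ^ (1 - (n : ℤ)) *
            χ ((w.1 - 𝒢.α 0 y 0 (‖w.2‖⁻¹ • w.2) 0 * ‖w.2‖ ^ 2) / ‖w.2‖) y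
              (‖w.2‖⁻¹ • w.2) : ℝ) : ℂ) * h w +
          ((Real.exp (-F * w.1) * ‖w.2‖ ^ (1 - (n : ℤ)) *
            χ ((-w.1 + 𝒢.α 0 y 0 (-(‖w.2‖⁻¹ • w.2)) 0 * ‖w.2‖ ^ 2) / ‖w.2‖) y
              (-(‖w.2‖⁻¹ • w.2)) : ℝ) : ℂ) * h w)
    · rw [e]
      exact key
    · simp only [boundaryKernel]
      push_cast
      ring
  · intro s θ r hr
    have hnorm : ‖r • (θ : Tang n)‖ = r := by simp [norm_smul, abs_of_pos hr]
    have hdir : r⁻¹ • r • (θ : Tang n) = θ := by rw [smul_smul, inv_mul_cancel₀ hr.ne', one_smul]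
    simp only [hnorm, hdir, hd, pulledKernel]
    have e1 : (r * s + 𝒢.α 0 y 0 θ 0 * r ^ 2 - 𝒢.α 0 y 0 θ 0 * r ^ 2) / r = s := by
      field_simp; ring
    rw [e1, Complex.real_smul, ← mul_assoc, ← Complex.ofReal_mul, mul_comm s r]
    congr 2
    linear_combination (Real.exp (-F * (r * s + 𝒢.α 0 y 0 θ 0 * r ^ 2)) * χ s y θ) * hpow r hr
  · intro s θ r hr
    have hnorm : ‖-(r • (θ : Tang n))‖ = r := by simp [norm_smul, abs_of_pos hr]
    have hdir : -(r⁻¹ • -(r • (θ : Tang n))) = θ := by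
      rw [smul_neg, neg_neg, smul_smul, inv_mul_cancel₀ hr.ne', one_smul]
    simp only [hnorm, hdir, hd, pulledKernel]
    have e1 : (-(r * s + 𝒢.α 0 y 0 θ 0 * r ^ 2) + 𝒢.α 0 y 0 θ 0 * r ^ 2) / r = -s := by
      field_simp; ring
    rw [e1, Complex.real_smul, ← mul_assoc, ← Complex.ofReal_mul, neg_mul_neg, neg_sq,
      mul_comm s r, neg_smul]
    congr 2
    linear_combination (Real.exp (-F * (r * s + 𝒢.α 0 y 0 θ 0 * r ^ 2)) * χ (-s) y θ) * hpow r hr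

theorem integrable_boundaryKernel (hn : 3 ≤ n) {χ : ℝ → Tang n → Tang n → ℝ}
    (hχ : IsCutoff K χ) {F : ℝ} (hF : 0 < F) {y : Tang n} (hy : y ∈ K) :
    Integrable (boundaryKernel 𝒢 χ F y) := by
  simpa using (𝒢.integral_boundaryKernel_mul hn hχ hF hy (h := fun _ => 1) continuous_const
    (H := 1) (by simp)).1

end CurveFamily

/-! ### Rescaling of the operator and pointwise limits along the curves. -/

theorem setIntegral_Ioo_rescale {E : Type*} [NormedAddCommGroup E] [NormedSpace ℝ E] {x : ℝ}
    (hx : 0 < x) (δ : ℝ) (H : ℝ → E) :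
    ∫ l in Ioo (-δ) δ, H l = x • ∫ s, (Ioo (-δ) δ).indicator H (x * s) := by
  rw [Measure.integral_comp_mul_left, abs_of_pos (inv_pos.2 hx), smul_smul,
    mul_inv_cancel₀ hx.ne', one_smul, integral_indicator measurableSet_Ioo]

namespace CurveFamily

variable {n : ℕ} {K : Set (Tang n)} (𝒢 : CurveFamily n K)

/-- The set of rescaled parameters `(s, θ, t)` for which the curve is defined. -/
def rescaledDomain (x : ℝ) : Set (ℝ × (Sph n × ℝ)) :=
  {p | x * p.1 ∈ Ioo (-𝒢.δ₀) 𝒢.δ₀ ∧ x * p.2.2 ∈ Ioo (-𝒢.δ₀) 𝒢.δ₀}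

/-- The integrand of the conjugated operator in the rescaled variables `l = x s`, `t = x τ`. -/
def rescaledIntegrand (χ : ℝ → Tang n → Tang n → ℝ) (F : ℝ) (f : ℝ × Tang n → ℂ) (x : ℝ)
    (y : Tang n) : ℝ × (Sph n × ℝ) → ℂ :=
  (𝒢.rescaledDomain x).indicator fun p =>
    (Real.exp (F / (𝒢.γ x y (x * p.1) p.2.1 (x * p.2.2)).1 - F / x) : ℝ) *
      f (𝒢.γ x y (x * p.1) p.2.1 (x * p.2.2)) * (χ p.1 y p.2.1 : ℝ)

/-- The two rescalings produce `x · x`, cancelling `x⁻¹` from the conjugation and `x⁻¹` from the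
weight. The integral stays iterated because Fubini needs integrability, which is available only for
small `x`. -/
theorem opAF_eq_integral (χ : ℝ → Tang n → Tang n → ℝ) (F : ℝ) (f : ℝ × Tang n → ℂ) {x : ℝ}
    (hx : 0 < x) (y : Tang n) :
    opAF 𝒢 χ F f (x, y) = ∫ s : ℝ, ∫ θ : Sph n,
      (∫ t : ℝ, 𝒢.rescaledIntegrand χ F f x y (s, (θ, t))) ∂((volume : Measure (Tang n)).toSphere) := by
  have hxc : (x : ℂ) ≠ 0 := by exact_mod_cast hx.ne'
  simp only [opAF, opA]
  rw [setIntegral_Ioo_rescale hx, Complex.real_smul, ← mul_assoc, ← integral_const_mul]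
  congr 1
  funext s
  by_cases hs : x * s ∈ Ioo (-𝒢.δ₀) 𝒢.δ₀
  · rw [indicator_of_mem hs, ← integral_const_mul]
    congr 1
    funext θ
    rw [rayTransform, setIntegral_Ioo_rescale hx, Complex.real_smul, mul_div_cancel_left₀ _ hx.ne']
    have e : ∀ I : ℂ, ((x⁻¹ * Real.exp (-F / x) : ℝ) : ℂ) * x *
        (x * I * ((x⁻¹ * χ s y θ : ℝ) : ℂ)) = (Real.exp (-F / x) * χ s y θ : ℝ) * I := by
      intro I
      push_cast
      field_simp
    rw [e, ← integral_const_mul]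
    congr 1
    funext t
    by_cases ht : x * t ∈ Ioo (-𝒢.δ₀) 𝒢.δ₀
    · rw [rescaledIntegrand, indicator_of_mem ht, indicator_of_mem (show (s, (θ, t)) ∈
        𝒢.rescaledDomain x from ⟨hs, ht⟩)]
      rw [sub_eq_add_neg, Real.exp_add, neg_div]
      push_cast
      ring
    · rw [rescaledIntegrand, indicator_of_notMem ht, indicator_of_notMem
        (fun h : (s, (θ, t)) ∈ 𝒢.rescaledDomain x => ht h.2), mul_zero]
  · rw [indicator_of_notMem hs, mul_zero]
    have : ∀ (θ : Sph n) (t : ℝ), 𝒢.rescaledIntegrand χ F f x y (s, (θ, t)) = 0 := fun θ t => by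
      rw [rescaledIntegrand, indicator_of_notMem
        (fun h : (s, (θ, t)) ∈ 𝒢.rescaledDomain x => hs h.1)]
    simp [this]

theorem mem_paramDomain_of_mem_rescaledDomain {x : ℝ} {y : Tang n} (hU : (x, y) ∈ 𝒢.U)
    {p : ℝ × (Sph n × ℝ)} (hp : p ∈ 𝒢.rescaledDomain x) :
    (x, y, x * p.1, (p.2.1 : Tang n), x * p.2.2) ∈ paramDomain n 𝒢.U 𝒢.δ₀ :=
  ⟨hU, abs_lt.2 hp.1, p.2.1.2, abs_lt.2 hp.2⟩

theorem measurableSet_rescaledDomain (x : ℝ) : MeasurableSet (𝒢.rescaledDomain x) :=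
  ((isOpen_Ioo.preimage (by fun_prop : Continuous fun p : ℝ × (Sph n × ℝ) => x * p.1)).inter
    (isOpen_Ioo.preimage
      (by fun_prop : Continuous fun p : ℝ × (Sph n × ℝ) => x * p.2.2))).measurableSet

theorem aestronglyMeasurable_rescaledIntegrand {χ : ℝ → Tang n → Tang n → ℝ}
    (hχ : IsCutoff K χ) {y : Tang n} (hy : y ∈ K) (F : ℝ) {f : ℝ × Tang n → ℂ} (hf : Measurable f)
    {x : ℝ} (hU : (x, y) ∈ 𝒢.U) :
    AEStronglyMeasurable (𝒢.rescaledIntegrand χ F f x y) (rayMeasure n) := by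
  have hD := 𝒢.measurableSet_rescaledDomain x
  rw [rescaledIntegrand, aestronglyMeasurable_indicator_iff hD]
  have hγ : ContinuousOn (fun p : ℝ × (Sph n × ℝ) => 𝒢.γ x y (x * p.1) p.2.1 (x * p.2.2))
      (𝒢.rescaledDomain x) :=
    𝒢.smooth_γ.continuousOn.comp
      (f := fun p : ℝ × (Sph n × ℝ) => (x, y, x * p.1, (p.2.1 : Tang n), x * p.2.2))
      (by fun_prop) fun p hp => 𝒢.mem_paramDomain_of_mem_rescaledDomain hU hp
  have hγm := hγ.aemeasurable (μ := rayMeasure n) hD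
  have hN : Measurable fun w : ℝ × Tang n => ((Real.exp (F / w.1 - F / x) : ℝ) : ℂ) * f w := by
    fun_prop
  have hχ' : Continuous fun p : ℝ × (Sph n × ℝ) => χ p.1 y p.2.1 :=
    (hχ.continuous_slice hy).comp (continuous_fst.prodMk (continuous_fst.comp continuous_snd))
  exact ((hN.comp_aemeasurable hγm).mul
    (Complex.continuous_ofReal.comp hχ').measurable.aemeasurable).aestronglyMeasurable

/-- Limit of the second-order Taylor remainder along the rescaled curves. -/
theorem tendsto_taylor_remainder (L : ℝ × Tang n →L[ℝ] ℝ) {y : Tang n} (hy : ((0 : ℝ), y) ∈ 𝒢.U)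
    (s : ℝ) (θ : Sph n) (t : ℝ) :
    Tendsto (fun x : ℝ => (L (𝒢.γ x y (x * s) θ (x * t)) - L (x, y) - x * t * L (x * s, (θ : Tang n)))
      / x ^ 2) (𝓝[>] 0) (𝓝 (t ^ 2 * L (𝒢.α 0 y 0 θ 0, 𝒢.β 0 y 0 θ 0))) := by
  have hev : ∀ c : ℝ, ∀ᶠ x : ℝ in 𝓝[>] 0, |x * c| < 𝒢.δ₀ := by
    intro c
    have : Tendsto (fun x : ℝ => |x * c|) (𝓝 0) (𝓝 0) := by
      have h : Continuous fun x : ℝ => |x * c| := by fun_prop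
      simpa using h.tendsto 0
    exact (this.mono_left nhdsWithin_le_nhds).eventually (gt_mem_nhds 𝒢.δ₀_pos)
  have hevU : ∀ᶠ x : ℝ in 𝓝[>] 0, (x, y) ∈ 𝒢.U := by
    have h : Continuous fun x : ℝ => (x, y) := by fun_prop
    exact (h.tendsto 0).mono_left nhdsWithin_le_nhds |>.eventually (𝒢.isOpen_U.mem_nhds hy)
  -- The intermediate point is chosen for every `x`, with default `0` when the parameters leave the
  -- domain; only small `x` matter for the limit.
  have hr : ∀ x : ℝ, ∃ r : ℝ, |r| ≤ |x * t| ∧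
      ((x, y, x * s, (θ : Tang n), x * t) ∈ paramDomain n 𝒢.U 𝒢.δ₀ →
        L (𝒢.γ x y (x * s) θ (x * t)) = L (x, y) + (x * t) * L (x * s, (θ : Tang n)) +
          (x * t) ^ 2 * L (𝒢.α x y (x * s) θ r, 𝒢.β x y (x * s) θ r)) := by
    intro x
    by_cases h : (x, y, x * s, (θ : Tang n), x * t) ∈ paramDomain n 𝒢.U 𝒢.δ₀
    · obtain ⟨r, hr, e⟩ := 𝒢.exists_taylor L h
      exact ⟨r, hr, fun _ => e⟩
    · exact ⟨0, by simpa only [abs_zero] using abs_nonneg _, fun h' => absurd h' h⟩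
  choose r hr1 hr2 using hr
  have hr0 : Tendsto r (𝓝[>] 0) (𝓝 0) := by
    have h : Continuous fun x : ℝ => |x * t| := by fun_prop
    have h2 : Tendsto (fun x : ℝ => |x * t|) (𝓝[>] 0) (𝓝 0) := by
      simpa using (h.tendsto 0).mono_left (nhdsWithin_le_nhds (s := Ioi 0))
    exact squeeze_zero_norm hr1 h2
  have hpt : Tendsto (fun x : ℝ => (x, y, x * s, (θ : Tang n), r x)) (𝓝[>] 0)
      (𝓝[paramDomain n 𝒢.U 𝒢.δ₀] (0, y, 0, (θ : Tang n), 0)) := by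
    refine tendsto_nhdsWithin_iff.2 ⟨?_, ?_⟩
    · have hid : Tendsto (fun x : ℝ => x) (𝓝[>] 0) (𝓝 0) := nhdsWithin_le_nhds
      have hs : Tendsto (fun x : ℝ => x * s) (𝓝[>] 0) (𝓝 0) := by
        simpa using hid.mul_const s
      exact hid.prodMk_nhds (tendsto_const_nhds.prodMk_nhds
        (hs.prodMk_nhds (tendsto_const_nhds.prodMk_nhds hr0)))
    · filter_upwards [hev s, hev t, hevU] with x h1 h2 h3
      exact ⟨h3, h1, θ.2, lt_of_le_of_lt (hr1 x) h2⟩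
  have hα := (𝒢.smooth_α.continuousOn _ (𝒢.mem_paramDomain_zero hy θ)).tendsto.comp hpt
  have hβ := (𝒢.smooth_β.continuousOn _ (𝒢.mem_paramDomain_zero hy θ)).tendsto.comp hpt
  have hlim := ((L.continuous.tendsto _).comp (hα.prodMk_nhds hβ)).const_mul (t ^ 2)
  refine hlim.congr' ?_
  filter_upwards [hev s, hev t, hevU, self_mem_nhdsWithin] with x h1 h2 h3 hx
  have hx0 : x ≠ 0 := ne_of_gt hx
  rw [hr2 x ⟨h3, h1, θ.2, h2⟩]
  simp only [Function.comp]
  field_simp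
  ring

/-- Convergence of the scattering coordinate `X` along the rescaled curves. -/
theorem tendsto_scattering_fst {y : Tang n} (hy : ((0 : ℝ), y) ∈ 𝒢.U) (s : ℝ) (θ : Sph n) (t : ℝ) :
    Tendsto (fun x : ℝ => ((𝒢.γ x y (x * s) θ (x * t)).1 - x) / x ^ 2) (𝓝[>] 0)
      (𝓝 (s * t + 𝒢.α 0 y 0 θ 0 * t ^ 2)) := by
  -- The linear term is `x t · x s`, already of order `x²`, so it survives the division as `s t`.
  have h := (𝒢.tendsto_taylor_remainder (ContinuousLinearMap.fst ℝ ℝ (Tang n)) hy s θ t).const_add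
    (s * t)
  rw [mul_comm (𝒢.α 0 y 0 θ 0)]
  refine h.congr' ?_
  filter_upwards [self_mem_nhdsWithin] with x hx
  have hx0 : x ≠ 0 := ne_of_gt hx
  simp only [ContinuousLinearMap.coe_fst']
  field_simp
  ring

/-- Convergence of the scattering coordinate `Y` along the rescaled curves. -/
theorem tendsto_scattering_snd {y : Tang n} (hy : ((0 : ℝ), y) ∈ 𝒢.U) (s : ℝ) (θ : Sph n) (t : ℝ) :
    Tendsto (fun x : ℝ => x⁻¹ • ((𝒢.γ x y (x * s) θ (x * t)).2 - y)) (𝓝[>] 0)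
      (𝓝 (t • (θ : Tang n))) := by
  have hco : ∀ i, Tendsto (fun x : ℝ => (x⁻¹ • ((𝒢.γ x y (x * s) θ (x * t)).2 - y)) i) (𝓝[>] 0)
      (𝓝 ((t • (θ : Tang n)) i)) := by
    intro i
    have hid : Tendsto (fun x : ℝ => x) (𝓝[>] 0) (𝓝 0) := nhdsWithin_le_nhds
    -- `Y` involves division by `x` only, so the second-order remainder carries an extra factor `x`
    -- and disappears, leaving `t θ`.
    have h := hid.mul (𝒢.tendsto_taylor_remainder
      ((EuclideanSpace.proj i).comp (ContinuousLinearMap.snd ℝ ℝ (Tang n))) hy s θ t)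
    have h2 := h.const_add (t * (θ : Tang n) i)
    rw [zero_mul, add_zero] at h2
    refine h2.congr' ?_
    filter_upwards [self_mem_nhdsWithin] with x hx
    have hx0 : x ≠ 0 := ne_of_gt hx
    have hp : ∀ v : Tang n, (EuclideanSpace.proj i : Tang n →L[ℝ] ℝ) v = v i := fun _ => rfl
    simp only [ContinuousLinearMap.comp_apply, ContinuousLinearMap.coe_snd', hp,
      PiLp.smul_apply, PiLp.sub_apply, smul_eq_mul]
    field_simp
    ring
  exact ((PiLp.continuous_toLp 2 (fun _ : Fin (n - 1) => ℝ)).tendsto _).comp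
    (tendsto_pi_nhds.2 hco)

end CurveFamily

/-! ### Dominated convergence to the front face. -/

namespace CurveFamily

variable {n : ℕ} {K : Set (Tang n)} (𝒢 : CurveFamily n K)

theorem iterated_integral_eq {G : ℝ × (Sph n × ℝ) → ℂ} (hG : Integrable G (rayMeasure n)) :
    ∫ s : ℝ, ∫ θ : Sph n, (∫ t : ℝ, G (s, (θ, t))) ∂((volume : Measure (Tang n)).toSphere) =
      ∫ p, G p ∂(rayMeasure n) := by
  rw [rayMeasure, integral_prod _ hG]
  refine integral_congr_ae ?_
  filter_upwards [hG.prod_right_ae] with s hs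
  exact (integral_prod _ hs).symm

/-- With `g = x' = x + x² X`, this is the source of `exp (-F X)` in the kernel: conjugation by `exp
(F / x)` stays bounded exactly on the scale `x' - x ~ x²`. -/
theorem div_sub_div_eq_of_eq_scattering {F x X g : ℝ} (hx : x ≠ 0) (h : 1 + x * X ≠ 0)
    (hg : g = x * (1 + x * X)) : F / g - F / x = -F * X / (1 + x * X) := by
  rw [hg, div_sub_div _ _ (mul_ne_zero hx h) hx,
    div_eq_div_iff (mul_ne_zero (mul_ne_zero hx h) hx) h]
  ring

theorem tendsto_rescaledIntegrand {χ : ℝ → Tang n → Tang n → ℝ} (F : ℝ) {y : Tang n}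
    (hy : ((0 : ℝ), y) ∈ 𝒢.U) {φ : ℝ × Tang n → ℂ} (hφ : Continuous φ) (p : ℝ × (Sph n × ℝ)) :
    Tendsto (fun x => 𝒢.rescaledIntegrand χ F (scatteringPullback φ x y) x y p) (𝓝[>] 0)
      (𝓝 (𝒢.pulledKernel χ F y φ p)) := by
  obtain ⟨s, θ, t⟩ := p
  have hX := 𝒢.tendsto_scattering_fst hy s θ t
  have hY := 𝒢.tendsto_scattering_snd hy s θ t
  have hid : Tendsto (fun x : ℝ => x) (𝓝[>] 0) (𝓝 0) := nhdsWithin_le_nhds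
  have hev : ∀ c : ℝ, ∀ᶠ x : ℝ in 𝓝[>] 0, x * c ∈ Ioo (-𝒢.δ₀) 𝒢.δ₀ := by
    intro c
    have : Tendsto (fun x : ℝ => x * c) (𝓝[>] 0) (𝓝 0) := by simpa using hid.mul_const c
    exact this.eventually (Ioo_mem_nhds (neg_lt_zero.2 𝒢.δ₀_pos) 𝒢.δ₀_pos)
  have hden : Tendsto (fun x : ℝ => 1 + x * (((𝒢.γ x y (x * s) θ (x * t)).1 - x) / x ^ 2)) (𝓝[>] 0)
      (𝓝 1) := by simpa using (hid.mul hX).const_add 1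
  have hexp : Tendsto (fun x : ℝ => F / (𝒢.γ x y (x * s) θ (x * t)).1 - F / x) (𝓝[>] 0)
      (𝓝 (-F * (s * t + 𝒢.α 0 y 0 θ 0 * t ^ 2))) := by
    have h := ((hX.const_mul (-F)).div hden one_ne_zero)
    rw [div_one] at h
    refine h.congr' ?_
    filter_upwards [self_mem_nhdsWithin, hden.eventually_ne one_ne_zero] with x hx h1
    have hx0 : x ≠ 0 := ne_of_gt hx
    have e : (𝒢.γ x y (x * s) θ (x * t)).1 =
        x * (1 + x * (((𝒢.γ x y (x * s) θ (x * t)).1 - x) / x ^ 2)) := by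
      field_simp; ring
    exact (div_sub_div_eq_of_eq_scattering hx0 h1 e).symm
  have hmain := ((Complex.continuous_ofReal.tendsto _).comp
    (((Real.continuous_exp.tendsto _).comp hexp).mul_const (χ s y θ))).mul
    ((hφ.tendsto _).comp (hX.prodMk_nhds hY))
  refine hmain.congr' ?_
  filter_upwards [hev s, hev t] with x h1 h2
  rw [rescaledIntegrand, indicator_of_mem (show (s, (θ, t)) ∈ 𝒢.rescaledDomain x from ⟨h1, h2⟩)]
  simp only [Function.comp, scatteringPullback]
  push_cast
  ring

/-- Uniform bound for the rescaled integrand, with support in a fixed compact set. -/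
theorem exists_rescaledIntegrand_bound {χ : ℝ → Tang n → Tang n → ℝ} (hχ : IsCutoff K χ) {F : ℝ}
    (hF : 0 < F) {y : Tang n} (hy : y ∈ K) {φ : ℝ × Tang n → ℂ} (hφ : Continuous φ)
    (hφs : HasCompactSupport φ) :
    ∃ R T B : ℝ, ∀ᶠ x : ℝ in 𝓝[>] 0, ∀ p : ℝ × (Sph n × ℝ),
      ‖𝒢.rescaledIntegrand χ F (scatteringPullback φ x y) x y p‖ ≤
        (Icc (-R) R ×ˢ (univ ×ˢ Icc (-T) T)).indicator (fun _ => B) p := by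
  obtain ⟨C, hC, hCα⟩ := 𝒢.convex
  obtain ⟨R, M, hR, hM, hχR, hχM⟩ := hχ.exists_bound hy
  obtain ⟨H, hH⟩ := hφ.bounded_above_of_compact_support hφs
  have hH0 : 0 ≤ H := (norm_nonneg _).trans (hH 0)
  obtain ⟨Q, hQ0, hQ⟩ : ∃ Q : ℝ, 0 ≤ Q ∧ ∀ w, φ w ≠ 0 → |w.1| ≤ Q := by
    obtain ⟨Q, hQ⟩ := hφs.isCompact.isBounded.exists_norm_le
    refine ⟨max Q 0, le_max_right _ _, fun w hw => ?_⟩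
    exact (norm_fst_le w).trans ((hQ w (subset_tsupport φ hw)).trans (le_max_left _ _))
  have hT0 : 0 ≤ (R + Q) / C := by positivity
  refine ⟨R, (R + Q) / C + 1, Real.exp (2 * F * Q) * H * M, ?_⟩
  have hevU : ∀ᶠ x : ℝ in 𝓝[>] 0, (x, y) ∈ 𝒢.U := by
    have h : Continuous fun x : ℝ => (x, y) := by fun_prop
    exact (h.tendsto 0).mono_left nhdsWithin_le_nhds |>.eventually
      (𝒢.isOpen_U.mem_nhds (𝒢.mem_U y hy))
  -- Keeps `1 + x X ≥ 1 / 2` on the support of `φ`, where `|X| ≤ Q`.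
  have hevx : ∀ᶠ x : ℝ in 𝓝[>] 0, x < 1 / (2 * (Q + 1)) :=
    (nhdsWithin_le_nhds : 𝓝[>] (0 : ℝ) ≤ 𝓝 0) (Iio_mem_nhds (by positivity))
  filter_upwards [hevU, hevx, self_mem_nhdsWithin] with x hU hx1 hx0 p
  have hx0 : 0 < x := hx0
  by_cases hz : 𝒢.rescaledIntegrand χ F (scatteringPullback φ x y) x y p = 0
  · rw [hz, norm_zero]
    exact indicator_nonneg (fun _ _ => by positivity) _
  have hD : p ∈ 𝒢.rescaledDomain x := by
    by_contra h
    exact hz (indicator_of_notMem h _)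
  rw [rescaledIntegrand, indicator_of_mem hD] at hz ⊢
  have hmem := 𝒢.mem_paramDomain_of_mem_rescaledDomain hU hD
  obtain ⟨r, hrt, hr⟩ := 𝒢.exists_taylor (ContinuousLinearMap.fst ℝ ℝ (Tang n)) hmem
  have hα := hCα _ _ _ _ r ⟨hU, hmem.2.1, hmem.2.2.1, lt_of_le_of_lt hrt hmem.2.2.2⟩
  simp only [ContinuousLinearMap.coe_fst'] at hr
  obtain ⟨s, θ, t⟩ := p
  simp only at hr hα hz ⊢
  have hφ0 : scatteringPullback φ x y (𝒢.γ x y (x * s) θ (x * t)) ≠ 0 := by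
    intro h; rw [h] at hz; simp at hz
  have hχ0 : χ s y θ ≠ 0 := by
    intro h; rw [h] at hz; simp at hz
  have hs : |s| ≤ R := not_lt.1 fun h => hχ0 (hχR s θ h)
  set X := ((𝒢.γ x y (x * s) θ (x * t)).1 - x) / x ^ 2 with hX
  have hXQ : |X| ≤ Q := hQ _ hφ0
  have hXe : X = s * t + 𝒢.α x y (x * s) θ r * t ^ 2 := by
    rw [hX, hr]
    field_simp
    ring
  have hst : -(R * |t|) ≤ s * t := by
    refine (neg_le_neg ?_).trans (neg_abs_le _)
    rw [abs_mul]
    exact mul_le_mul_of_nonneg_right hs (abs_nonneg _)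
  -- Convexity confines `t`: a point of the curve with `|X| ≤ Q` and `|s| ≤ R` satisfies this
  -- quadratic inequality.
  have hC2 : C * |t| ^ 2 ≤ R * |t| + Q := by
    have h1 := mul_le_mul_of_nonneg_right hα (sq_nonneg t)
    have h2 := (le_abs_self X).trans hXQ
    rw [sq_abs]
    linarith
  have ht : |t| ≤ (R + Q) / C + 1 := by
    by_contra h
    have h1 : (R + Q) / C + 1 < |t| := not_le.1 h
    have h2 : 1 ≤ |t| := by linarith
    have h3 : (R + Q) / C < |t| := by linarith
    rw [div_lt_iff₀ hC] at h3
    nlinarith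
  rw [indicator_of_mem (show (s, (θ, t)) ∈ Icc (-R) R ×ˢ (univ ×ˢ Icc (-((R + Q) / C + 1))
    ((R + Q) / C + 1)) from ⟨mem_Icc.2 (abs_le.1 hs), mem_univ _, mem_Icc.2 (abs_le.1 ht)⟩)]
  have hxX : |x * X| ≤ 1 / 2 := by
    rw [abs_mul, abs_of_pos hx0]
    calc x * |X| ≤ 1 / (2 * (Q + 1)) * (Q + 1) := by
          refine mul_le_mul hx1.le (by linarith) (abs_nonneg _) (by positivity)
      _ = 1 / 2 := by field_simp
  have hden : 1 / 2 ≤ 1 + x * X := by have := (abs_le.1 hxX).1; linarith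
  have hexp : F / (𝒢.γ x y (x * s) θ (x * t)).1 - F / x ≤ 2 * F * Q := by
    rw [div_sub_div_eq_of_eq_scattering (X := X) hx0.ne' (by linarith)
      (by rw [hX]; field_simp; ring), div_le_iff₀ (by linarith)]
    have h1 : -(F * Q) ≤ F * X := by
      rw [← mul_neg]; exact mul_le_mul_of_nonneg_left (abs_le.1 hXQ).1 hF.le
    nlinarith [mul_nonneg hF.le hQ0]
  rw [norm_mul, norm_mul, Complex.norm_real, Complex.norm_real, Real.norm_eq_abs, Real.abs_exp,
    Real.norm_eq_abs]
  gcongr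
  · exact hH _
  · exact hχM _ _

/-- The uniform bound plays two roles: it dominates the integrands as `x → 0+`, and for each small
`x` it supplies the integrability that merges the iterated integral into one over `rayMeasure`. -/
theorem tendsto_opAF (hn : 3 ≤ n) {χ : ℝ → Tang n → Tang n → ℝ} (hχ : IsCutoff K χ) {F : ℝ}
    (hF : 0 < F) {y : Tang n} (hy : y ∈ K) {φ : ℝ × Tang n → ℂ} (hφ : Continuous φ)
    (hφs : HasCompactSupport φ) :
    Tendsto (fun x : ℝ => opAF 𝒢 χ F (scatteringPullback φ x y) (x, y)) (𝓝[>] 0)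
      (𝓝 (∫ w, boundaryKernel 𝒢 χ F y w * φ w)) := by
  obtain ⟨H, hH⟩ := hφ.bounded_above_of_compact_support hφs
  rw [(𝒢.integral_boundaryKernel_mul hn hχ hF hy hφ hH).2]
  obtain ⟨R, T, B, hB⟩ := 𝒢.exists_rescaledIntegrand_bound hχ hF hy hφ hφs
  have hevU : ∀ᶠ x : ℝ in 𝓝[>] 0, (x, y) ∈ 𝒢.U := by
    have h : Continuous fun x : ℝ => (x, y) := by fun_prop
    exact (h.tendsto 0).mono_left nhdsWithin_le_nhds |>.eventually
      (𝒢.isOpen_U.mem_nhds (𝒢.mem_U y hy))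
  have hbi : Integrable ((Icc (-R) R ×ˢ (univ ×ˢ Icc (-T) T) : Set (ℝ × (Sph n × ℝ))).indicator
      fun _ => B) (rayMeasure n) := by
    refine (integrable_indicator_iff
      (measurableSet_Icc.prod (MeasurableSet.univ.prod measurableSet_Icc))).2 ?_
    refine integrableOn_const ?_
    rw [Measure.prod_prod, Measure.prod_prod]
    exact (ENNReal.mul_lt_top (by simp)
      (ENNReal.mul_lt_top (measure_lt_top _ _) (by simp))).ne
  have hmeas : ∀ᶠ x : ℝ in 𝓝[>] 0, AEStronglyMeasurable
      (𝒢.rescaledIntegrand χ F (scatteringPullback φ x y) x y) (rayMeasure n) := by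
    filter_upwards [hevU] with x hU
    refine 𝒢.aestronglyMeasurable_rescaledIntegrand hχ hy F ?_ hU
    exact (hφ.comp (by fun_prop)).measurable
  have hlim := tendsto_integral_filter_of_dominated_convergence (μ := rayMeasure n) _ hmeas
    (hB.mono fun x h => .of_forall h) hbi
    (.of_forall fun p => 𝒢.tendsto_rescaledIntegrand (χ := χ) F (𝒢.mem_U y hy) hφ p)
  refine hlim.congr' ?_
  filter_upwards [self_mem_nhdsWithin, hmeas, hB] with x hx hm hb
  rw [𝒢.opAF_eq_integral χ F _ hx, iterated_integral_eq (hbi.mono' hm (.of_forall hb))]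

end CurveFamily

/-! ### The symbol for the adapted cutoff as a spherical integral of model symbols. -/

theorem integral_comp_mul_prod (g : ℝ × ℝ → ℂ) {c d : ℝ} (hc : 0 < c) (hd : 0 < d) :
    ∫ p : ℝ × ℝ, g (c * p.1, d * p.2) = (c⁻¹ * d⁻¹ : ℝ) * ∫ p, g p := by
  have h : (volume : Measure (ℝ × ℝ)).map (Prod.map (c * ·) (d * ·)) =
      ENNReal.ofReal (c⁻¹ * d⁻¹) • volume := by
    rw [Measure.volume_eq_prod, ← Measure.map_prod_map _ _ (by fun_prop) (by fun_prop),
      Real.map_volume_mul_left hc.ne', Real.map_volume_mul_left hd.ne', Measure.prod_smul_left,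
      Measure.prod_smul_right, smul_smul, ← ENNReal.ofReal_mul (abs_nonneg _), abs_of_pos (by positivity),
      abs_of_pos (by positivity)]
  have he : MeasurableEmbedding (Prod.map (c * ·) (d * ·) : ℝ × ℝ → ℝ × ℝ) :=
    (measurableEmbedding_mulLeft₀ hc.ne').prodMap (measurableEmbedding_mulLeft₀ hd.ne')
  have h2 := he.integral_map (μ := volume) g
  rw [h, integral_smul_measure, ENNReal.toReal_ofReal (by positivity)] at h2
  rw [← Complex.real_smul, h2]
  rfl

namespace CurveFamily

variable {n : ℕ} {K : Set (Tang n)} (𝒢 : CurveFamily n K)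

/-- Reordering of the variables `(θ, (s, t)) ↦ (s, (θ, t))`. -/
def sphereFirst (n : ℕ) : Sph n × (ℝ × ℝ) ≃ᵐ ℝ × (Sph n × ℝ) :=
  MeasurableEquiv.prodAssoc.symm.trans
    ((MeasurableEquiv.prodComm.prodCongr (MeasurableEquiv.refl ℝ)).trans MeasurableEquiv.prodAssoc)

theorem measurePreserving_sphereFirst (n : ℕ) :
    MeasurePreserving (sphereFirst n) (((volume : Measure (Tang n)).toSphere).prod volume)
      (rayMeasure n) :=
  ((measurePreserving_prodAssoc _ _ _).comp (Measure.measurePreserving_swap.prod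
    (MeasurePreserving.id volume))).comp
    ((measurePreserving_prodAssoc _ (volume : Measure ℝ) (volume : Measure ℝ)).symm _)

/-- The cutoff whose profile is adapted to the curvature of the curves. -/
def scaledCutoff (ψ : ℝ → ℝ) (F : ℝ) (s : ℝ) (y θ : Tang n) : ℝ :=
  ψ (s * Real.sqrt (F / 𝒢.α 0 y 0 θ 0))

/-- Convexity bounds `α` only from below. The upper bound comes from compactness of a neighbourhood
of `K` inside the slice `x = 0` of `U`, and its interior serves as the open set on which the cutoff
is smooth. -/
theorem exists_curvature_bounds (hK : IsCompact K) :
    ∃ (V : Set (Tang n)) (C C₂ : ℝ), IsOpen V ∧ K ⊆ V ∧ 0 < C ∧ 0 < C₂ ∧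
      (∀ y ∈ V, ((0 : ℝ), y) ∈ 𝒢.U) ∧
      ∀ y ∈ V, ∀ θ : Sph n, C ≤ 𝒢.α 0 y 0 θ 0 ∧ 𝒢.α 0 y 0 θ 0 ≤ C₂ := by
  obtain ⟨C, hC, hCα⟩ := 𝒢.convex
  have hO : IsOpen {y : Tang n | ((0 : ℝ), y) ∈ 𝒢.U} :=
    𝒢.isOpen_U.preimage (by fun_prop : Continuous fun y : Tang n => ((0 : ℝ), y))
  obtain ⟨L, hL, hKL, hLU⟩ := exists_compact_between hK hO fun y hy => 𝒢.mem_U y hy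
  have hc : ContinuousOn (fun p : Tang n × Sph n => 𝒢.α 0 p.1 0 p.2 0) (L ×ˢ univ) :=
    𝒢.smooth_α.continuousOn.comp
      (f := fun p : Tang n × Sph n => ((0 : ℝ), p.1, (0 : ℝ), (p.2 : Tang n), (0 : ℝ)))
      (by fun_prop) fun p hp => 𝒢.mem_paramDomain_zero (hLU hp.1) p.2
  obtain ⟨M, hM⟩ := (hL.prod isCompact_univ).exists_bound_of_continuousOn hc
  refine ⟨interior L, C, max M 1, isOpen_interior, hKL, hC, lt_max_of_lt_right one_pos,
    fun y hy => hLU (interior_subset hy), fun y hy θ => ⟨?_, ?_⟩⟩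
  · exact hCα _ _ _ _ _ (𝒢.mem_paramDomain_zero (hLU (interior_subset hy)) θ)
  · exact (le_abs_self _).trans ((hM (y, θ) ⟨interior_subset hy, mem_univ _⟩).trans
      (le_max_left _ _))

/-- The lower bound on `α` keeps `√(F / α)` smooth; the upper bound keeps it away from zero, so the
support in `s` is uniformly compact. -/
theorem isCutoff_scaledCutoff (hK : IsCompact K) {F : ℝ} (hF : 0 < F) {ψ : ℝ → ℝ}
    (hψ : ContDiff ℝ ∞ ψ) {R : ℝ} (hR : ∀ s, R < |s| → ψ s = 0) :
    IsCutoff K (𝒢.scaledCutoff ψ F) := by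
  obtain ⟨V, C, C₂, hV, hKV, hC, hC₂, hVU, hα⟩ := 𝒢.exists_curvature_bounds hK
  refine ⟨V, hV, hKV, ?_, max R 0 / Real.sqrt (F / C₂), fun s y hy θ hθ hs => ?_⟩
  · have hsm : ContDiffOn ℝ ∞ (fun p : ℝ × Tang n × Tang n => 𝒢.α 0 p.2.1 0 p.2.2 0)
        (univ ×ˢ V ×ˢ Metric.sphere (0 : Tang n) 1) :=
      𝒢.smooth_α.comp (f := fun p : ℝ × Tang n × Tang n =>
        ((0 : ℝ), p.2.1, (0 : ℝ), p.2.2, (0 : ℝ))) (by fun_prop)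
        fun p hp => 𝒢.mem_paramDomain_zero (hVU _ hp.2.1) ⟨p.2.2, hp.2.2⟩
    have hpos : ∀ p ∈ (univ ×ˢ V ×ˢ Metric.sphere (0 : Tang n) 1 : Set (ℝ × Tang n × Tang n)),
        0 < 𝒢.α 0 p.2.1 0 p.2.2 0 := fun p hp =>
      lt_of_lt_of_le hC (hα p.2.1 hp.2.1 ⟨p.2.2, hp.2.2⟩).1
    exact hψ.comp_contDiffOn (contDiff_fst.contDiffOn.mul
      ((contDiffOn_const.div hsm fun p hp => (hpos p hp).ne').sqrt
        fun p hp => (div_pos hF (hpos p hp)).ne'))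
  · have h1 := hα y hy ⟨θ, hθ⟩
    simp only at h1
    have ha : 0 < 𝒢.α 0 y 0 θ 0 := lt_of_lt_of_le hC h1.1
    refine hR _ (lt_of_le_of_lt (le_max_left R 0) ?_)
    rw [div_lt_iff₀ (Real.sqrt_pos.2 (by positivity))] at hs
    refine hs.trans_le ?_
    rw [abs_mul, abs_of_nonneg (Real.sqrt_nonneg _)]
    refine mul_le_mul_of_nonneg_left (Real.sqrt_le_sqrt ?_) (abs_nonneg _)
    exact div_le_div_of_nonneg_left hF.le ha h1.2

/-- The plane wave `exp (-i (ξ X + η · Y))`. -/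
def planeWave (ξ : ℝ) (η : Tang n) (w : ℝ × Tang n) : ℂ :=
  Complex.exp (-Complex.I * ((ξ * w.1 + inner ℝ η w.2 : ℝ) : ℂ))

theorem continuous_planeWave (ξ : ℝ) (η : Tang n) : Continuous (planeWave ξ η) := by
  unfold planeWave
  fun_prop

theorem norm_planeWave (ξ : ℝ) (η : Tang n) (w : ℝ × Tang n) : ‖planeWave ξ η w‖ = 1 := by
  rw [planeWave, Complex.norm_exp]
  simp

/-- The scalings `c` of `s` and `d` of `t` satisfy `c d = F` and `d² = α F`, so `F (s t + α t²)`
becomes the curvature-free form `s t + t²`. The curvature survives only in the frequency dual to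
`t`. -/
theorem integral_pulledKernel_slice (ψ : ℝ → ℝ) {F : ℝ} (hF : 0 < F) {y : Tang n} (θ : Sph n)
    (ha : 0 < 𝒢.α 0 y 0 θ 0) (ξ : ℝ) (η : Tang n) :
    ∫ q : ℝ × ℝ, 𝒢.pulledKernel (𝒢.scaledCutoff ψ F) F y (planeWave ξ η) (sphereFirst n (θ, q)) =
      (F⁻¹ : ℝ) * modelSymbol ψ (ξ / F) (inner ℝ η (θ : Tang n) / Real.sqrt (𝒢.α 0 y 0 θ 0 * F)) := by
  set a := 𝒢.α 0 y 0 θ 0 with hadef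
  set c := Real.sqrt (F / a) with hc
  set d := Real.sqrt (a * F) with hd
  have hc0 : 0 < c := Real.sqrt_pos.2 (by positivity)
  have hd0 : 0 < d := Real.sqrt_pos.2 (by positivity)
  have hcd : c * d = F := by
    rw [hc, hd, ← Real.sqrt_mul (by positivity)]
    have : F / a * (a * F) = F ^ 2 := by field_simp
    rw [this, Real.sqrt_sq hF.le]
  have hd2 : d ^ 2 = a * F := Real.sq_sqrt (by positivity)
  have hinv : c⁻¹ * d⁻¹ = F⁻¹ := by rw [← mul_inv, hcd]
  rw [modelSymbol, ← hinv, ← integral_comp_mul_prod _ hc0 hd0]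
  refine integral_congr_ae (.of_forall fun q => ?_)
  obtain ⟨s, t⟩ := q
  have e0 : sphereFirst n (θ, (s, t)) = (s, (θ, t)) := rfl
  simp only [e0, pulledKernel, scaledCutoff, planeWave, ← hadef, ← hc, inner_smul_right]
  rw [Complex.ofReal_mul, Complex.ofReal_exp, mul_right_comm, ← Complex.exp_add, mul_comm s c]
  congr 2
  have h1 : (c : ℂ) * d = F := by exact_mod_cast hcd
  have h2 : (d : ℂ) ^ 2 = a * F := by exact_mod_cast hd2
  have hFc : (F : ℂ) ≠ 0 := by exact_mod_cast hF.ne'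
  have hdc : (d : ℂ) ≠ 0 := by exact_mod_cast hd0.ne'
  have e1 : ((c * s : ℝ) : ℂ) * ((d * t : ℝ) : ℂ) + ((d * t : ℝ) : ℂ) ^ 2 =
      F * (s * t + a * t ^ 2) := by
    push_cast
    linear_combination (s * t : ℂ) * h1 + (t ^ 2 : ℂ) * h2
  rw [e1]
  push_cast
  field_simp
  ring

/-- The boundary principal symbol for the adapted cutoff, as an integral over the sphere. -/
theorem fourierXY_scaledCutoff (hn : 3 ≤ n) (hK : IsCompact K) {F : ℝ} (hF : 0 < F) {ψ : ℝ → ℝ}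
    (hψ : ContDiff ℝ ∞ ψ) {R : ℝ} (hR : ∀ s, R < |s| → ψ s = 0) {y : Tang n} (hy : y ∈ K) (ξ : ℝ)
    (η : Tang n) :
    Integrable (fun θ : Sph n => modelSymbol ψ (ξ / F)
      (inner ℝ η (θ : Tang n) / Real.sqrt (𝒢.α 0 y 0 θ 0 * F)))
      (volume : Measure (Tang n)).toSphere ∧
    fourierXY (boundaryKernel 𝒢 (𝒢.scaledCutoff ψ F) F y) ξ η =
      (F⁻¹ : ℝ) * ∫ θ : Sph n, modelSymbol ψ (ξ / F)
        (inner ℝ η (θ : Tang n) / Real.sqrt (𝒢.α 0 y 0 θ 0 * F))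
        ∂(volume : Measure (Tang n)).toSphere := by
  obtain ⟨C, hC, hCα⟩ := 𝒢.convex
  have ha : ∀ θ : Sph n, 0 < 𝒢.α 0 y 0 θ 0 := fun θ =>
    lt_of_lt_of_le hC (hCα _ _ _ _ _ (𝒢.mem_paramDomain_zero (𝒢.mem_U y hy) θ))
  have hχ := 𝒢.isCutoff_scaledCutoff hK hF hψ hR
  have hint := 𝒢.integrable_pulledKernel hχ hF hy (continuous_planeWave ξ η)
    (fun w => (norm_planeWave ξ η w).le)
  have hint2 := ((measurePreserving_sphereFirst n).integrable_comp_emb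
    (sphereFirst n).measurableEmbedding).2 hint
  have hFc : ((F⁻¹ : ℝ) : ℂ) ≠ 0 := by exact_mod_cast (inv_pos.2 hF).ne'
  constructor
  · have h := hint2.integral_prod_left
    simp only [Function.comp, 𝒢.integral_pulledKernel_slice ψ hF _ (ha _)] at h
    exact (integrable_const_mul_iff hFc.isUnit _).1 h
  · have e : fourierXY (boundaryKernel 𝒢 (𝒢.scaledCutoff ψ F) F y) ξ η =
        ∫ w, boundaryKernel 𝒢 (𝒢.scaledCutoff ψ F) F y w * planeWave ξ η w :=
      integral_congr_ae (.of_forall fun w => mul_comm _ _)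
    rw [e, (𝒢.integral_boundaryKernel_mul hn hχ hF hy (continuous_planeWave ξ η)
      (fun w => (norm_planeWave ξ η w).le)).2, ← (measurePreserving_sphereFirst n).integral_comp
      (sphereFirst n).measurableEmbedding, ← integral_const_mul]
    refine (integral_prod _ hint2).trans ?_
    exact integral_congr_ae (.of_forall fun θ => 𝒢.integral_pulledKernel_slice ψ hF θ (ha θ) ξ η)

end CurveFamily

/-! ### Conclusion: the front-face kernel and ellipticity. -/

namespace CurveFamily

variable {n : ℕ} {K : Set (Tang n)} (𝒢 : CurveFamily n K)

theorem hasFrontFaceKernel_opAF (hn : 3 ≤ n) {χ : ℝ → Tang n → Tang n → ℝ} (hχ : IsCutoff K χ)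
    {F : ℝ} (hF : 0 < F) {y : Tang n} (hy : y ∈ K) :
    HasFrontFaceKernel (opAF 𝒢 χ F) y (boundaryKernel 𝒢 χ F y) :=
  ⟨𝒢.integrable_boundaryKernel hn hχ hF hy,
    fun _ hφ hφs => 𝒢.tendsto_opAF hn hχ hF hy hφ.continuous hφs⟩

end CurveFamily

theorem exists_unit_smul_eq {E : Type*} [NormedAddCommGroup E] [NormedSpace ℝ E] [Nontrivial E]
    (η : E) : ∃ e : E, ‖e‖ = 1 ∧ η = ‖η‖ • e := by
  by_cases h : η = 0
  · obtain ⟨e, he⟩ := exists_norm_eq E (zero_le_one (α := ℝ))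
    exact ⟨e, he, by simp [h]⟩
  · have h0 : ‖η‖ ≠ 0 := norm_ne_zero_iff.2 h
    exact ⟨‖η‖⁻¹ • η, by simp [norm_smul, h0], by rw [smul_smul, mul_inv_cancel₀ h0, one_smul]⟩

namespace CurveFamily

variable {n : ℕ} {K : Set (Tang n)} (𝒢 : CurveFamily n K)

/-- Integrated over the sphere, the Gaussian main term is at least `(2π / w) c / √(1 + B₁)`, and the
truncation error is at most half of that. The product `w² (1 + B₁)` equals `1 + ξ² / F² + |η|² / (2
C F)`, which is comparable to the squared Japanese bracket. -/
theorem exists_elliptic_cutoff (hn : 3 ≤ n) (hK : IsCompact K) {F : ℝ} (hF : 0 < F) :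
    ∃ χ : ℝ → Tang n → Tang n → ℝ, IsCutoff K χ ∧ (∀ s y θ, 0 ≤ χ s y θ) ∧ (∀ y θ, χ 0 y θ = 1) ∧
      ∃ c : ℝ, 0 < c ∧ ∀ y ∈ K, ∀ (ξ : ℝ) (η : Tang n),
        c * (japanese ξ η)⁻¹ ≤ ‖fourierXY (boundaryKernel 𝒢 χ F y) ξ η‖ := by
  have hd : Module.finrank ℝ (Tang n) = n - 1 := by simp
  have : Nontrivial (Tang n) := Module.nontrivial_of_finrank_pos (R := ℝ) (by omega)
  obtain ⟨V, C, C₂, -, hKV, hC, hC₂, -, hα⟩ := 𝒢.exists_curvature_bounds hK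
  obtain ⟨A, hA, hAle⟩ := integral_sphere_gaussian_le (E := Tang n)
  obtain ⟨c, hc, hcle⟩ := le_integral_sphere_gaussian (E := Tang n) (by omega)
  set D := Real.sqrt (1 + 4 * C₂ / C) with hD
  have hD0 : 0 < D := Real.sqrt_pos.2 (by positivity)
  -- `A` is the upper spherical constant, `c` the lower one, and `D` compares `√(1 + B₁)` with `√(1
  -- + B₂)`; this `ε` makes the error half of the main term.
  obtain ⟨ψ, hψ, ⟨R, hR⟩, hψ0, hψ1, happ⟩ :=
    exists_modelSymbol_approx (ε := c / (2 * A * D)) (by positivity)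
  refine ⟨𝒢.scaledCutoff ψ F, 𝒢.isCutoff_scaledCutoff hK hF hψ hR, fun s y θ => hψ0 _,
    fun y θ => by simp [scaledCutoff, hψ1], ?_⟩
  set N := Real.sqrt (1 + 1 / F ^ 2 + 1 / (2 * C * F)) with hN
  have hN0 : 0 < N := Real.sqrt_pos.2 (by positivity)
  refine ⟨Real.pi * c / (F * N), by positivity, fun y hy ξ η => ?_⟩
  obtain ⟨hint, hσ⟩ := 𝒢.fourierXY_scaledCutoff hn hK hF hψ hR hy ξ η
  rw [hσ]
  set w := Real.sqrt (1 + (ξ / F) ^ 2) with hw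
  have hw0 : 0 < w := Real.sqrt_pos.2 (by positivity)
  have hw2 : w ^ 2 = 1 + (ξ / F) ^ 2 := Real.sq_sqrt (by positivity)
  obtain ⟨e, he, hηe⟩ := exists_unit_smul_eq η
  set σ := (volume : Measure (Tang n)).toSphere with hσdef
  set a : Sph n → ℝ := fun θ => 𝒢.α 0 y 0 θ 0 with ha
  have haC : ∀ θ, C ≤ a θ ∧ a θ ≤ C₂ := fun θ => hα y (hKV hy) θ
  have hacont : Continuous a := 𝒢.continuous_accel (𝒢.mem_U y hy)
  set u : Sph n → ℝ := fun θ => inner ℝ η (θ : Tang n) / Real.sqrt (a θ * F) / w with hu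
  have ha0 : ∀ θ, 0 < a θ := fun θ => lt_of_lt_of_le hC (haC θ).1
  have hucont : Continuous u := by
    refine ((continuous_const.inner continuous_subtype_val).div
      (Real.continuous_sqrt.comp (hacont.mul continuous_const)) fun θ => ?_).div_const w
    exact (Real.sqrt_pos.2 (mul_pos (ha0 θ) hF)).ne'
  have hu2 : ∀ θ, u θ ^ 2 = ‖η‖ ^ 2 * (inner ℝ e (θ : Tang n)) ^ 2 / (a θ * F * w ^ 2) := by
    intro θ
    simp only [hu]
    rw [div_pow, div_pow, Real.sq_sqrt (mul_pos (ha0 θ) hF).le, div_div]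
    congr 1
    conv_lhs => rw [hηe]
    rw [real_inner_smul_left, mul_pow]
  -- `B₁` bounds the main Gaussian `exp (-u² / 2)` from below through `α ≥ C`; `B₂` bounds the error
  -- Gaussian `exp (-u² / 8)` from above through `α ≤ C₂`. Their ratio `4 C₂ / C` does not depend on
  -- the frequencies.
  set B₁ := ‖η‖ ^ 2 / (2 * C * F * w ^ 2) with hB₁
  set B₂ := ‖η‖ ^ 2 / (8 * C₂ * F * w ^ 2) with hB₂
  have hB₁0 : 0 ≤ B₁ := by positivity
  have hB₂0 : 0 ≤ B₂ := by positivity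
  have hlow : ∀ θ : Sph n, Real.exp (-B₁ * (inner ℝ e (θ : Tang n)) ^ 2) ≤
      Real.exp (-(u θ) ^ 2 / 2) := by
    intro θ
    refine Real.exp_le_exp.2 ?_
    have h1 : u θ ^ 2 ≤ ‖η‖ ^ 2 * (inner ℝ e (θ : Tang n)) ^ 2 / (C * F * w ^ 2) := by
      rw [hu2]
      have := (haC θ).1
      gcongr
    have h2 : B₁ * (inner ℝ e (θ : Tang n)) ^ 2 =
        ‖η‖ ^ 2 * (inner ℝ e (θ : Tang n)) ^ 2 / (C * F * w ^ 2) / 2 := by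
      rw [hB₁]; field_simp
    linarith
  have hupp : ∀ θ : Sph n, Real.exp (-(u θ) ^ 2 / 8) ≤
      Real.exp (-B₂ * (inner ℝ e (θ : Tang n)) ^ 2) := by
    intro θ
    refine Real.exp_le_exp.2 ?_
    have h1 : ‖η‖ ^ 2 * (inner ℝ e (θ : Tang n)) ^ 2 / (C₂ * F * w ^ 2) ≤ u θ ^ 2 := by
      rw [hu2]
      have := (haC θ).2
      have := ha0 θ
      gcongr
    have h2 : B₂ * (inner ℝ e (θ : Tang n)) ^ 2 =
        ‖η‖ ^ 2 * (inner ℝ e (θ : Tang n)) ^ 2 / (C₂ * F * w ^ 2) / 8 := by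
      rw [hB₂]; field_simp
    linarith
  have hci : ∀ f : Sph n → ℝ, Continuous f → Integrable f σ := fun f hf =>
    hf.integrable_of_hasCompactSupport (HasCompactSupport.of_compactSpace f)
  set Φ : Sph n → ℂ := fun θ => modelSymbol ψ (ξ / F)
    (inner ℝ η (θ : Tang n) / Real.sqrt (a θ * F)) with hΦ
  set m : Sph n → ℝ := fun θ => 2 * Real.pi / w * Real.exp (-(u θ) ^ 2 / 2) with hm
  have hmi : Integrable m σ := hci _ (by fun_prop)
  have hΦm : ‖∫ θ, (Φ θ - (m θ : ℂ)) ∂σ‖ ≤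
      2 * Real.pi / w * (c / (2 * A * D)) * (A / Real.sqrt (1 + B₂)) := by
    calc _ ≤ ∫ θ : Sph n, 2 * Real.pi / w * (c / (2 * A * D)) *
          Real.exp (-B₂ * (inner ℝ e (θ : Tang n)) ^ 2) ∂σ := by
          refine norm_integral_le_of_norm_le (hci _ (by fun_prop)) (.of_forall fun θ => ?_)
          exact (happ _ _).trans ((mul_le_mul_of_nonneg_left (mul_le_mul_of_nonneg_left (hupp θ)
            (by positivity)) (by positivity)).trans_eq (mul_assoc _ _ _).symm)
      _ ≤ _ := by
          rw [integral_const_mul]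
          exact mul_le_mul_of_nonneg_left (hAle e B₂ he hB₂0) (by positivity)
  have hmlow : 2 * Real.pi / w * (c / Real.sqrt (1 + B₁)) ≤ ∫ θ, m θ ∂σ := by
    simp only [hm]
    rw [integral_const_mul]
    refine mul_le_mul_of_nonneg_left ((hcle e B₁ he hB₁0).trans ?_) (by positivity)
    exact integral_mono (hci _ (by fun_prop)) (hci _ (by fun_prop)) hlow
  have hsqrt : Real.sqrt (1 + B₁) ≤ D * Real.sqrt (1 + B₂) := by
    rw [hD, ← Real.sqrt_mul (by positivity)]
    refine Real.sqrt_le_sqrt ?_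
    have h1 : B₁ = 4 * C₂ / C * B₂ := by rw [hB₁, hB₂]; field_simp; ring
    have h2 : 0 ≤ 4 * C₂ / C := by positivity
    rw [h1]
    nlinarith
  have herr : (c / (2 * A * D)) * (A / Real.sqrt (1 + B₂)) ≤ c / 2 / Real.sqrt (1 + B₁) := by
    have e1 : (c / (2 * A * D)) * (A / Real.sqrt (1 + B₂)) =
        c / 2 / (D * Real.sqrt (1 + B₂)) := by field_simp
    rw [e1]
    exact div_le_div_of_nonneg_left (by positivity) (Real.sqrt_pos.2 (by positivity)) hsqrt
  have hmain : 2 * Real.pi / w * (c / 2 / Real.sqrt (1 + B₁)) ≤ ‖∫ θ, Φ θ ∂σ‖ := by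
    have h1 : ∫ θ, Φ θ ∂σ = ∫ θ, (Φ θ - (m θ : ℂ)) ∂σ + ((∫ θ, m θ ∂σ : ℝ) : ℂ) := by
      have hmi' : Integrable (fun θ => (m θ : ℂ)) σ := hmi.ofReal
      rw [integral_sub hint hmi', integral_complex_ofReal]
      ring
    have h2 : ‖((∫ θ, m θ ∂σ : ℝ) : ℂ)‖ ≤ ‖∫ θ, Φ θ ∂σ‖ + ‖∫ θ, (Φ θ - (m θ : ℂ)) ∂σ‖ := by
      have : ((∫ θ, m θ ∂σ : ℝ) : ℂ) = ∫ θ, Φ θ ∂σ - ∫ θ, (Φ θ - (m θ : ℂ)) ∂σ := by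
        rw [h1]; ring
      rw [this]
      exact norm_sub_le _ _
    have h3 : ∫ θ, m θ ∂σ ≤ ‖((∫ θ, m θ ∂σ : ℝ) : ℂ)‖ := by
      rw [Complex.norm_real]; exact le_abs_self _
    have h4 := mul_le_mul_of_nonneg_left herr (by positivity : 0 ≤ 2 * Real.pi / w)
    have h5 : 2 * Real.pi / w * (c / Real.sqrt (1 + B₁)) =
        2 * Real.pi / w * (c / 2 / Real.sqrt (1 + B₁)) +
        2 * Real.pi / w * (c / 2 / Real.sqrt (1 + B₁)) := by ring
    rw [← mul_assoc] at h4
    linarith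
  have hjap : w * Real.sqrt (1 + B₁) ≤ N * japanese ξ η := by
    rw [hw, hN, japanese, ← Real.sqrt_mul (by positivity), ← Real.sqrt_mul (by positivity)]
    refine Real.sqrt_le_sqrt ?_
    have h1 : (1 + (ξ / F) ^ 2) * (1 + B₁) =
        1 + 1 / F ^ 2 * ξ ^ 2 + 1 / (2 * C * F) * ‖η‖ ^ 2 := by
      rw [← hw2, mul_add, hB₁]
      have : w ^ 2 * (‖η‖ ^ 2 / (2 * C * F * w ^ 2)) = 1 / (2 * C * F) * ‖η‖ ^ 2 := by field_simp
      rw [this, hw2]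
      ring
    rw [h1]
    have p1 : 0 ≤ 1 / F ^ 2 := by positivity
    have p2 : 0 ≤ 1 / (2 * C * F) := by positivity
    nlinarith [mul_nonneg p1 (sq_nonneg ‖η‖), mul_nonneg p2 (sq_nonneg ξ), sq_nonneg ξ,
      sq_nonneg ‖η‖]
  have hs0 : 0 < Real.sqrt (1 + B₁) := Real.sqrt_pos.2 (by positivity)
  rw [norm_mul, Complex.norm_real, Real.norm_of_nonneg (inv_pos.2 hF).le]
  refine le_trans ?_ (mul_le_mul_of_nonneg_left hmain (inv_pos.2 hF).le)
  have e1 : F⁻¹ * (2 * Real.pi / w * (c / 2 / Real.sqrt (1 + B₁))) =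
      Real.pi * c / F / (w * Real.sqrt (1 + B₁)) := by field_simp
  have e2 : Real.pi * c / (F * N) * (japanese ξ η)⁻¹ = Real.pi * c / F / (N * japanese ξ η) := by
    rw [← div_eq_mul_inv, div_div, div_div, mul_assoc]
  rw [e1, e2]
  exact div_le_div_of_nonneg_left (by positivity) (by positivity) hjap

end CurveFamily

end LocalXray

end

theorem proposition2p3 (n : ℕ) (hn : 3 ≤ n) (K : Set (LocalXray.Tang n)) (hK : IsCompact K)
    (𝒢 : LocalXray.CurveFamily n K) (F : ℝ) (hF : 0 < F) :
    (∀ χ : ℝ → LocalXray.Tang n → LocalXray.Tang n → ℝ, LocalXray.IsCutoff K χ → ∀ y ∈ K,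
      LocalXray.HasFrontFaceKernel (LocalXray.opAF 𝒢 χ F) y (LocalXray.boundaryKernel 𝒢 χ F y) ∧
      LocalXray.HasBoundarySymbol (LocalXray.opAF 𝒢 χ F) y
        (LocalXray.fourierXY (LocalXray.boundaryKernel 𝒢 χ F y))) ∧
    ∃ χ : ℝ → LocalXray.Tang n → LocalXray.Tang n → ℝ,
      LocalXray.IsCutoff K χ ∧ (∀ s y θ, 0 ≤ χ s y θ) ∧ (∀ y θ, χ 0 y θ = 1) ∧
      LocalXray.IsBoundaryElliptic K (LocalXray.opAF 𝒢 χ F) := by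
  refine ⟨fun χ hχ y hy => ⟨𝒢.hasFrontFaceKernel_opAF hn hχ hF hy,
    _, 𝒢.hasFrontFaceKernel_opAF hn hχ hF hy, rfl⟩, ?_⟩
  obtain ⟨χ, hχ, h0, h1, c, hc, hcle⟩ := 𝒢.exists_elliptic_cutoff hn hK hF
  exact ⟨χ, hχ, h0, h1, fun y => LocalXray.fourierXY (LocalXray.boundaryKernel 𝒢 χ F y),
    fun y hy => ⟨_, 𝒢.hasFrontFaceKernel_opAF hn hχ hF hy, rfl⟩, c, hc, hcle⟩
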